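/- Let $A\in\mathrm{SL}(2,\mathbb Z)$ be hyperbolic, i.e. $|\mathrm{Tr}(A)|>2$, and put $D=\mathrm{Tr}(A)^2-4$, $\omega(n,m)=n_1m_2-n_2m_1$ and $Q(n)=\omega(nA,n)$ for row vectors $n,m\in\mathbb Z^2$. Write $e_N(x)=e^{2\pi i x/N}$. *Setting.* On $\mathcal H_N=L^2(\mathbb Z/N\mathbb Z)$, with inner product $\langle\phi,\psi\rangle=\frac1N\sum_{y}\phi(y)\overline{\psi(y)}$, let $T_N(n)\psi(y)=e_{2N}(n_1n_2)\,e_N(n_2y)\,\psi(y+n_1)$ for $n\in\mathbb Z^2$, and let $\mathrm{Op}_N(f)=\sum_{n\in\mathbb Z^2}\hat f(n)T_N(n)$ for an observable $f$ on $\mathbb T^2=\mathbb R^2/\mathbb Z^2$ with Fourier coefficients $\hat f(n)$. Put $\widetilde T_N(n)=(-1)^{n_1n_2}T_N(n)$. For odd $N$, a quantum propagator is a representation $U_N$ of $\mathrm{SL}(2,\mathbb Z/N\mathbb Z)$ by unitary operators on $\mathcal H_N$ such that $U_N(B)^{-1}\widetilde T_N(n)U_N(B)=\widetilde T_N(m)$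 whenever $m\equiv nB\pmod N$. For a prime power $p^k$ let $C(p^k)=\{B\in\mathrm{SL}(2,\mathbb Z/p^k\mathbb Z): AB=BA\}$ be the Hecke group and $\hat C(p^k)$ its group of characters. A Hecke eigenfunction with joint eigenvalue $\chi\in\hat C(p^k)$ is a $\psi\neq0$ in $\mathcal H_{p^k}$ with $U_{p^k}(B)\psi=\chi(B)\psi$ for all $B\in C(p^k)$. Let $X(p^k)=\{x\in\mathbb Z/p^k\mathbb Z: Dx^2\not\equiv1\pmod p\}$, let $\beta(x)=(xS+1)(xS-1)^{-1}\in C(p^k)$ for $x\in X(p^k)$, where $S=A-A^{-1}$ (so that $S^2=D$), and for $\nu\in\mathbb Z/p^k\mathbb Z$ and $\chi\in\hat C(p^k)$ let $$E_{p^k}(\nu,\chi)=\sum_{x\in X(p^k)}e_{p^k}(\nu x)\,\chi(\beta(x)).$$ *Theorem.* For every odd prime $p$ and every $k\ge1$ a quantum propagator exists for $N=p^k$. For any choice of propagators $U_{p^k}$ ($p$ an odd prime, $k\geq 1$) there are subsets $\hat C_0(p^k)\subset\hat C(p^k)$, characters $\chi_0=\chi_{0,p^k}\in\hat C(p^k)$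 and signs $\varepsilon_{p,k}\in\{\pm1\}$ such that, for every fixed $k\ge1$, $\lim_{p\to\infty}|\hat C_0(p^k)|/p^k=1$ (the limit being over primes $p$), and such that for every odd prime $p$, every $k\ge1$ and every $\chi\in\hat C_0(p^k)$: 1. there is a Hecke eigenfunction with joint eigenvalue $\chi$, and it is unique up to multiplication by a scalar; 2. if $\psi$ is a Hecke eigenfunction with joint eigenvalue $\chi$, normalized by $\langle\psi,\psi\rangle=1$, then for every $n\in\mathbb Z^2$ with $Q(n)\not\equiv0\pmod p$ and $f_n(x)=e^{2\pi i n\cdot x}$, $$\langle\mathrm{Op}_{p^k}(f_n)\psi,\psi\rangle=\varepsilon_{p,k}\,\frac{(-1)^{n_1n_2}}{\#C(p^k)}\,E_{p^k}\!\left(\tfrac{Q(n)}2,\chi\chi_0\right),$$ where $\tfrac{Q(n)}2$ means $Q(n)\cdot2^{-1}$ in $\mathbb Z/p^k\mathbb Z$. -/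

import Mathlib

open Matrix
open scoped MatrixGroups ComplexConjugate

namespace CatMap

/-! ### Quantum kinematics -/

/-- The space of states `L²(ℤ/Nℤ)`. -/
abbrev State (N : ℕ) : Type := ZMod N → ℂ

/-- `⟨φ, ψ⟩ = (1/N) ∑ φ(y) conj ψ(y)`. -/
noncomputable def braket {N : ℕ} [NeZero N] (φ ψ : State N) : ℂ :=
  (1 / (N : ℂ)) * ∑ y : ZMod N, φ y * conj (ψ y)

/-- The elementary operator
`(T_N(n) ψ)(y) = e_{2N}(n₁ n₂) e_N(n₂ y) ψ(y + n₁)`, where `n₁ = n 0` and `n₂ = n 1`. -/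
noncomputable def elemOp (N : ℕ) [NeZero N] (n : Fin 2 → ℤ) : Module.End ℂ (State N) where
  toFun ψ := fun y =>
    Complex.exp (2 * Real.pi * Complex.I * ((n 0 : ℂ) * (n 1 : ℂ)) / (2 * (N : ℂ)))
      * ZMod.stdAddChar ((n 1 : ZMod N) * y) * ψ (y + (n 0 : ZMod N))
  map_add' φ ψ := by
    funext y
    simp only [Pi.add_apply, mul_add]
  map_smul' c ψ := by
    funext y
    simp only [Pi.smul_apply, smul_eq_mul, RingHom.id_apply]
    ring

/-- The twisted elementary operator `(-1)^{n₁ n₂} T_N(n)`. -/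
noncomputable def twistedOp (N : ℕ) [NeZero N] (n : Fin 2 → ℤ) : Module.End ℂ (State N) :=
  ((-1 : ℂ) ^ (n 0 * n 1)) • elemOp N n

/-- The quantization `Op_N(f) = ∑ₙ f̂(n) T_N(n)` of an observable `f` on the torus `ℝ²/ℤ²`,
applied to the state `ψ`. -/
noncomputable def opN (N : ℕ) [NeZero N] (f : UnitAddTorus (Fin 2) → ℂ) (ψ : State N) :
    State N :=
  fun y => ∑' n : Fin 2 → ℤ, UnitAddTorus.mFourierCoeff f n * elemOp N n ψ y

/-! ### Quantum dynamics -/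

/-- `U` is a quantum propagator of level `N` (`N` odd): a representation of `SL(2, ℤ/Nℤ)` by
unitary operators such that `U(B)⁻¹ T U(B) = T'` whenever `T`, `T'` are the twisted elementary
operators at `n` and at `m ≡ nB (mod N)`. -/
structure IsPropagator (N : ℕ) [NeZero N] (U : SL(2, ZMod N) →* Module.End ℂ (State N)) :
    Prop where
  unitary : ∀ (B : SL(2, ZMod N)) (φ ψ : State N), braket (U B φ) (U B ψ) = braket φ ψ
  egorov : ∀ (B : SL(2, ZMod N)) (n m : Fin 2 → ℤ),
    (fun i => (m i : ZMod N)) = (fun i => (n i : ZMod N)) ᵥ* (B : Matrix (Fin 2) (Fin 2) (ZMod N)) →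
    U B⁻¹ * twistedOp N n * U B = twistedOp N m

/-! ### The Hecke group and its characters -/

/-- The reduction of `A` modulo `N`. -/
def red (A : SL(2, ℤ)) (N : ℕ) : SL(2, ZMod N) :=
  Matrix.SpecialLinearGroup.map (Int.castRingHom (ZMod N)) A

/-- The Hecke group `C(N) = {B ∈ SL(2, ℤ/Nℤ) | AB = BA}`. -/
def heckeGroup (A : SL(2, ℤ)) (N : ℕ) : Subgroup SL(2, ZMod N) :=
  Subgroup.centralizer {red A N}

/-- Characters of the Hecke group. -/
abbrev HeckeChar (A : SL(2, ℤ)) (N : ℕ) : Type := heckeGroup A N →* ℂˣ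

/-- `ψ` is a Hecke eigenfunction with joint eigenvalue `χ`. -/
def IsHeckeEigenfunction {A : SL(2, ℤ)} {N : ℕ} (U : SL(2, ZMod N) →* Module.End ℂ (State N))
    (χ : HeckeChar A N) (ψ : State N) : Prop :=
  ψ ≠ 0 ∧ ∀ B : heckeGroup A N, U B ψ = (χ B : ℂ) • ψ

/-! ### The exponential sums -/

/-- `D = Tr(A)² - 4`. -/
def disc (A : SL(2, ℤ)) : ℤ := (A : Matrix (Fin 2) (Fin 2) ℤ).trace ^ 2 - 4

/-- The standard symplectic form `ω(n, m) = n₁ m₂ - n₂ m₁`. -/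
def symp (n m : Fin 2 → ℤ) : ℤ := n 0 * m 1 - n 1 * m 0

/-- The quadratic form `Q(n) = ω(nA, n)`. -/
def quadForm (A : SL(2, ℤ)) (n : Fin 2 → ℤ) : ℤ :=
  symp (n ᵥ* (A : Matrix (Fin 2) (Fin 2) ℤ)) n

/-- `X(p^k) = {x ∈ ℤ/p^kℤ | D x² ≢ 1 (mod p)}`. -/
def paramSet (A : SL(2, ℤ)) (p k : ℕ) : Set (ZMod (p ^ k)) :=
  {x | (disc A : ZMod p) * (x.cast : ZMod p) ^ 2 ≠ 1}

/-- The matrix `A - A⁻¹` modulo `N`, whose square is `D`; it plays the role of `√D`. -/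
def sqrtDisc (A : SL(2, ℤ)) (N : ℕ) : Matrix (Fin 2) (Fin 2) (ZMod N) :=
  (red A N : Matrix (Fin 2) (Fin 2) (ZMod N)) -
    ((red A N)⁻¹ : SL(2, ZMod N))

lemma isUnit_of_cast_ne_zero {p k : ℕ} [Fact p.Prime] (y : ZMod (p ^ k))
    (hy : (y.cast : ZMod p) ≠ 0) : IsUnit y := by
  rw [← ZMod.natCast_zmod_val y, ZMod.isUnit_iff_coprime]
  refine Nat.Coprime.pow_right k (Nat.Coprime.symm ?_)
  rw [Nat.Prime.coprime_iff_not_dvd Fact.out, ← ZMod.natCast_eq_zero_iff, ZMod.natCast_val]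
  exact hy

lemma det_smul_sqrtDisc_add (A : SL(2, ℤ)) (N : ℕ) (x s : ZMod N) (hs : s * s = 1) :
    (x • sqrtDisc A N + s • (1 : Matrix (Fin 2) (Fin 2) (ZMod N))).det
      = 1 - (disc A : ZMod N) * x ^ 2 := by
  have h : ((red A N : Matrix (Fin 2) (Fin 2) (ZMod N))).det = 1 := (red A N).2
  rw [Matrix.det_fin_two] at h
  have e : ∀ i j, (red A N : Matrix (Fin 2) (Fin 2) (ZMod N)) i j = ((A i j : ℤ) : ZMod N) :=
    fun i j => rfl
  simp only [e] at h
  simp only [sqrtDisc, Matrix.SpecialLinearGroup.coe_inv, Matrix.adjugate_fin_two, disc,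
    Matrix.trace_fin_two, Matrix.det_fin_two, Matrix.add_apply, Matrix.smul_apply,
    Matrix.sub_apply, e, Matrix.of_apply, Matrix.cons_val', Matrix.cons_val_zero,
    Matrix.cons_val_one, Matrix.one_apply, smul_eq_mul]
  push_cast
  simp
  linear_combination (4 * x ^ 2) * h + hs

lemma isUnit_det_of_mem {A : SL(2, ℤ)} {p k : ℕ} [Fact p.Prime] {x : ZMod (p ^ k)}
    (hx : x ∈ paramSet A p k) :
    IsUnit (x • sqrtDisc A (p ^ k) - (1 : Matrix (Fin 2) (Fin 2) (ZMod (p ^ k)))).det := by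
  have h := det_smul_sqrtDisc_add A (p ^ k) x (-1) (by ring)
  rw [neg_one_smul, ← sub_eq_add_neg] at h
  rw [h]
  rcases Nat.eq_zero_or_pos k with rfl | hk
  · have : Subsingleton (ZMod (p ^ 0)) := by rw [pow_zero]; infer_instance
    exact isUnit_of_subsingleton _
  · apply isUnit_of_cast_ne_zero
    have hd : p ∣ p ^ k := dvd_pow_self p hk.ne'
    rw [ZMod.cast_sub hd, ZMod.cast_mul hd, ZMod.cast_pow hd, ZMod.cast_one hd,
      ZMod.cast_intCast hd]
    exact sub_ne_zero.mpr (Ne.symm hx)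

/-- The element `(√D x + 1) / (√D x - 1)` of `SL(2, ℤ/p^kℤ)`, with `√D` read as `A - A⁻¹`. -/
noncomputable def betaSL (A : SL(2, ℤ)) (p k : ℕ) [Fact p.Prime] (x : paramSet A p k) :
    SL(2, ZMod (p ^ k)) :=
  ⟨((x : ZMod (p ^ k)) • sqrtDisc A (p ^ k) + 1) *
      ((x : ZMod (p ^ k)) • sqrtDisc A (p ^ k) - 1)⁻¹, by
    have hu := isUnit_det_of_mem x.2
    have h1 := det_smul_sqrtDisc_add A (p ^ k) x 1 (by ring)
    have h2 := det_smul_sqrtDisc_add A (p ^ k) x (-1) (by ring)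
    rw [one_smul] at h1
    rw [neg_one_smul, ← sub_eq_add_neg] at h2
    rw [Matrix.det_mul, h1, ← h2, Matrix.det_nonsing_inv, Ring.mul_inverse_cancel _ hu]⟩

lemma betaSL_mem (A : SL(2, ℤ)) (p k : ℕ) [Fact p.Prime] (x : paramSet A p k) :
    betaSL A p k x ∈ heckeGroup A (p ^ k) := by
  rw [heckeGroup, Subgroup.mem_centralizer_singleton_iff]
  apply Subtype.ext
  have hA : Commute (red A (p ^ k) : Matrix (Fin 2) (Fin 2) (ZMod (p ^ k)))
      (sqrtDisc A (p ^ k)) := by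
    refine (Commute.refl _).sub_right ?_
    have h := (Commute.refl (red A (p ^ k))).inv_right
    exact congrArg Subtype.val h
  have hP := (hA.smul_right (x : ZMod (p ^ k))).add_right (Commute.one_right _)
  have hM := (hA.smul_right (x : ZMod (p ^ k))).sub_right (Commute.one_right _)
  have hI : Commute (red A (p ^ k) : Matrix (Fin 2) (Fin 2) (ZMod (p ^ k)))
      ((x : ZMod (p ^ k)) • sqrtDisc A (p ^ k) - 1)⁻¹ := by
    obtain ⟨u, hu⟩ := (Matrix.isUnit_iff_isUnit_det _).mpr (isUnit_det_of_mem x.2)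
    rw [Matrix.nonsing_inv_eq_ringInverse, ← hu, Ring.inverse_unit]
    rw [← hu] at hM
    exact hM.units_inv_right
  exact (hP.mul_right hI).symm.eq

/-- The map `β` from `X(p^k)` to the Hecke group `C(p^k)`. -/
noncomputable def beta (A : SL(2, ℤ)) (p k : ℕ) [Fact p.Prime] (x : paramSet A p k) :
    heckeGroup A (p ^ k) :=
  ⟨betaSL A p k x, betaSL_mem A p k x⟩

open Classical in
/-- The exponential sum `E_{p^k}(ν, χ) = ∑_{x ∈ X(p^k)} e_{p^k}(ν x) χ(β(x))`. -/
noncomputable def expSum (A : SL(2, ℤ)) (p k : ℕ) [Fact p.Prime] (ν : ZMod (p ^ k))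
    (χ : HeckeChar A (p ^ k)) : ℂ :=
  ∑ x : paramSet A p k, ZMod.stdAddChar (ν * (x : ZMod (p ^ k))) * (χ (beta A p k x) : ℂ)

end CatMap

/-! The twisted operators $T(n)=\widetilde T_N(n)$ depend only on $n$ modulo $N$, satisfy
$T(n)T(m)=e_N(\omega(n,m)/2)T(n+m)$ and span all matrices. By Schur's lemma each $B$ has an
intertwiner, obtained by averaging (`isIntertwiner_average`) and unique up to a scalar. Intertwiners
commute with parity, and the even states have one dimension more than the odd ones. The ratio of the
two determinants therefore fixes the scalar multiplicatively and gives a representation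
(`exists_weil_matrix`).

Let $N=p^k$ with $p\nmid 2D$. The Hecke group $C$ is the group of norm-one elements $a+bS$,
$a^2-Db^2=1$. It is commutative, and $\beta$ is a bijection from $X(p^k)$ onto the complement of the
subgroup $K$ of elements trivial modulo $p$.

Multiplicity one: $|\mathrm{tr}\,U(B)|^2$ counts the fixed vectors of $B$ (`trace_mul_trace_inv`).
Outside $K$ only $0$ is fixed, and over $K$ the counts add up to at most $p^{2k}+O_k(p^{2k-1})$. If
$d_\chi$ are the multiplicities, then $\sum d_\chi=p^k$, $\sum d_\chi^2\le p^k+O_k(p^{k-1})$, and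
there are $p^k+O(p^{k-1})$ characters. Hence $\sum(d_\chi-1)^2=O_k(p^{k-1})$, and all but few
characters have $d_\chi=1$. These form $\hat C_0$.

Expectation values: when $d_\chi=1$ the spectral projection is
$\phi\mapsto\langle\phi,\psi\rangle\psi$, so $\langle
T(n)\psi,\psi\rangle=|C|^{-1}\sum_B\chi(B)\,\mathrm{tr}(T(n)U(B)^{-1})$. For $B\in K$ the trace
vanishes, because some $T(p^{k-1}m)$ commutes with $U(B)$ but multiplies $T(n)$ by a nontrivial root
of unity under conjugation. For $B=\beta(x)$ the trace is $e_N(xQ(n)/2)\,t(x)$ with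
$t(x)=\mathrm{tr}\,U(\beta(x))^{-1}$ (`trace_heis_mul_beta`).

It remains to see that $t$ is a sign times a character. Plancherel gives
$p^k\,\mathrm{tr}\,U(\beta(x)\beta(y))^{-1}=t(x)t(y)G(x+y)$ with the Gauss sum $G(z)=\sum_n
e_N(zQ(n)/2)$. Norms $a^2-Db^2$ represent every unit, so $G(u)=\varepsilon p^k$ for all units $u$
with one sign $\varepsilon$. Thus $\varepsilon t$ is multiplicative off $K$ and extends to a
character $\chi_0$ (`exists_char_eq_trace_beta`). -/

namespace CatMap

/-! ### The Heisenberg matrices -/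

section Heisenberg

/-- The symplectic form on `(ℤ/Nℤ)²`. -/
def sympMod {R : Type*} [CommRing R] (n m : Fin 2 → R) : R := n 0 * m 1 - n 1 * m 0

lemma two_mul_inv_two {N : ℕ} (hN : Odd N) : (2 : ZMod N) * 2⁻¹ = 1 := by
  have := ZMod.coe_mul_inv_eq_one (n := N) 2 (Nat.coprime_two_left.mpr hN)
  exact_mod_cast this

variable {N : ℕ} [NeZero N]

/-- The matrix of the twisted elementary operator, as a function of `n` modulo `N`. -/
noncomputable def heis (n : Fin 2 → ZMod N) : Matrix (ZMod N) (ZMod N) ℂ :=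
  fun y z => if z = y + n 0 then ZMod.stdAddChar (n 0 * n 1 * 2⁻¹ + n 1 * y) else 0

/-- The symmetric phase $n_1n_2/2$ makes the cocycle exactly half the symplectic form. It is
therefore invariant under $\mathrm{SL}_2$. -/
lemma heis_mul (hN : Odd N) (n m : Fin 2 → ZMod N) :
    heis n * heis m = (ZMod.stdAddChar (sympMod n m * 2⁻¹) : ℂ) • heis (n + m) := by
  ext y z
  have h2 := two_mul_inv_two hN
  rw [Matrix.mul_apply, Finset.sum_eq_single (y + n 0)
    (fun j _ hj => by simp [heis, hj]) (by simp)]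
  simp only [heis, if_true, Matrix.smul_apply, smul_eq_mul, mul_ite, mul_zero, ← add_assoc,
    Pi.add_apply, ← AddChar.map_add_eq_mul, sympMod]
  split_ifs
  · congr 1
    linear_combination (-n 0 * m 1) * h2
  · rfl

lemma heis_zero : heis (0 : Fin 2 → ZMod N) = 1 := by
  ext y z
  simp [heis, Matrix.one_apply, eq_comm]

lemma sympMod_self {R : Type*} [CommRing R] (n : Fin 2 → R) : sympMod n n = 0 := by
  simp only [sympMod]; ring

lemma sympMod_neg_left {R : Type*} [CommRing R] (n m : Fin 2 → R) :
    sympMod (-n) m = -sympMod n m := by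
  simp only [sympMod, Pi.neg_apply]; ring

lemma sympMod_neg_right {R : Type*} [CommRing R] (n m : Fin 2 → R) :
    sympMod n (-m) = -sympMod n m := by
  simp only [sympMod, Pi.neg_apply]; ring

lemma sympMod_vecMul {R : Type*} [CommRing R] (B : SL(2, R)) (n m : Fin 2 → R) :
    sympMod (n ᵥ* (B : Matrix (Fin 2) (Fin 2) R)) (m ᵥ* (B : Matrix (Fin 2) (Fin 2) R))
      = sympMod n m := by
  have h := B.2
  rw [Matrix.det_fin_two] at h
  simp only [sympMod, Matrix.vecMul, dotProduct, Fin.sum_univ_two]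
  linear_combination (n 0 * m 1 - n 1 * m 0) * h

lemma heis_mul_neg (hN : Odd N) (n : Fin 2 → ZMod N) : heis n * heis (-n) = 1 := by
  rw [heis_mul hN, sympMod_neg_right, sympMod_self]
  simp [heis_zero]

lemma heis_neg_mul (hN : Odd N) (n : Fin 2 → ZMod N) : heis (-n) * heis n = 1 := by
  simpa using heis_mul_neg hN (-n)

lemma heis_conjTranspose (hN : Odd N) (n : Fin 2 → ZMod N) : (heis n)ᴴ = heis (-n) := by
  ext y z
  have h2 := two_mul_inv_two hN
  simp only [heis, Matrix.conjTranspose_apply, Pi.neg_apply]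
  by_cases h : y = z + n 0
  · subst h
    simp only [if_true, add_neg_cancel_right, RCLike.star_def, ← AddChar.map_neg_eq_conj]
    congr 1
    linear_combination (-n 0 * n 1) * h2
  · rw [if_neg h, if_neg, star_zero]
    rintro rfl
    simp at h

lemma sum_stdAddChar_mul (a : ZMod N) :
    ∑ x : ZMod N, (ZMod.stdAddChar (x * a) : ℂ) = if a = 0 then (N : ℂ) else 0 := by
  have := AddChar.sum_mulShift (R' := ℂ) a (ZMod.isPrimitive_stdAddChar N)
  rw [this]
  split_ifs <;> simp [ZMod.card]

lemma sum_fin_two_fun {R M : Type*} [Fintype R] [AddCommMonoid M] (f : (Fin 2 → R) → M) :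
    ∑ n : Fin 2 → R, f n = ∑ a : R, ∑ b : R, f ![a, b] := by
  rw [← Fintype.sum_prod_type' (f := fun a b => f ![a, b])]
  exact Fintype.sum_equiv (finTwoArrowEquiv R) _ _ (fun n => by
    congr 1; ext i; fin_cases i <;> rfl)

lemma trace_heis (n : Fin 2 → ZMod N) :
    (heis n).trace = if n = 0 then (N : ℂ) else 0 := by
  simp only [Matrix.trace, Matrix.diag, heis]
  by_cases h0 : n 0 = 0
  · have hz : n = 0 ↔ n 1 = 0 := by
      constructor
      · rintro rfl; rfl
      · intro h1; ext i; fin_cases i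
        · exact h0
        · exact h1
    simp only [h0, add_zero, if_true, zero_mul, zero_add, hz, mul_comm (n 1)]
    exact sum_stdAddChar_mul _
  · have : n ≠ 0 := by rintro rfl; exact h0 rfl
    simp [h0, this]

/-- Completeness of the Heisenberg matrices. -/
lemma sum_heis_entries (hN : Odd N) (z u v w : ZMod N) :
    ∑ n : Fin 2 → ZMod N, heis (-n) z u * heis n v w =
      if z = w ∧ u = v then (N : ℂ) else 0 := by
  have h2 := two_mul_inv_two hN
  rw [sum_fin_two_fun]
  have key : ∀ a b : ZMod N, heis (-![a, b]) z u * heis ![a, b] v w =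
      if a = w - v then (if u + w = z + v then
        (ZMod.stdAddChar (b * (w - z)) : ℂ) else 0) else 0 := by
    intro a b
    have e1 : heis (-![a, b]) z u = if u = z + -a then
        (ZMod.stdAddChar (-a * -b * 2⁻¹ + -b * z) : ℂ) else 0 := rfl
    have e2 : heis ![a, b] v w = if w = v + a then
        (ZMod.stdAddChar (a * b * 2⁻¹ + b * v) : ℂ) else 0 := rfl
    rw [e1, e2]
    by_cases ha : a = w - v
    · subst ha
      rw [if_pos (show w = v + (w - v) by ring), if_pos rfl]
      by_cases hu : u + w = z + v
      · rw [if_pos hu, if_pos (by linear_combination hu), ← AddChar.map_add_eq_mul]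
        congr 1
        linear_combination (b * (w - v)) * h2
      · rw [if_neg hu, if_neg, zero_mul]
        intro h; apply hu; linear_combination h
    · rw [if_neg ha, if_neg (show ¬ w = v + a from fun h => ha (by linear_combination -h)),
        mul_zero]
  simp only [key]
  rw [Finset.sum_eq_single (w - v) (fun a _ ha => by simp [ha]) (by simp)]
  simp only [if_true]
  by_cases hu : u + w = z + v
  · simp only [if_pos hu, sum_stdAddChar_mul, sub_eq_zero]
    refine if_congr ?_ rfl rfl
    constructor
    · rintro rfl; exact ⟨rfl, by linear_combination hu⟩
    · rintro ⟨rfl, -⟩; rfl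
  · simp only [if_neg hu, Finset.sum_const_zero]
    rw [if_neg]
    rintro ⟨rfl, rfl⟩; exact hu (add_comm _ _)

/-- Conjugating over all Heisenberg matrices projects onto scalars. This is completeness read entry
by entry, and it yields both Schur's lemma and the fixed-point formula. -/
lemma sum_heis_conj (hN : Odd N) (X : Matrix (ZMod N) (ZMod N) ℂ) :
    ∑ n : Fin 2 → ZMod N, heis (-n) * X * heis n = ((N : ℂ) * X.trace) • 1 := by
  ext z w
  have : ∀ n : Fin 2 → ZMod N, (heis (-n) * X * heis n) z w =
      ∑ v, ∑ u, X u v * (heis (-n) z u * heis n v w) := by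
    intro n
    simp only [Matrix.mul_apply, Finset.sum_mul]
    exact Finset.sum_congr rfl fun v _ => Finset.sum_congr rfl fun u _ => by ring
  rw [Matrix.sum_apply]
  simp only [this]
  rw [Finset.sum_comm]
  have h2 : ∀ v, ∑ n : Fin 2 → ZMod N, ∑ u, X u v * (heis (-n) z u * heis n v w) =
      if z = w then X v v * N else 0 := by
    intro v
    rw [Finset.sum_comm]
    simp only [← Finset.mul_sum, sum_heis_entries hN]
    by_cases h : z = w <;> simp [h]
  simp only [h2, Matrix.smul_apply, Matrix.one_apply, smul_eq_mul, Matrix.trace, Matrix.diag]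
  by_cases h : z = w
  · simp [h, ← Finset.sum_mul, mul_comm]
  · simp [h]

/-- Plancherel's identity for the Heisenberg basis. It will turn the trace of a product of
propagators into a Gauss sum. -/
lemma sum_trace_heis_mul (hN : Odd N) (X Y : Matrix (ZMod N) (ZMod N) ℂ) :
    ∑ n : Fin 2 → ZMod N, (heis (-n) * X).trace * (heis n * Y).trace
      = (N : ℂ) * (X * Y).trace := by
  have h1 : ∀ n : Fin 2 → ZMod N, (heis (-n) * X).trace * (heis n * Y).trace =
      ∑ z, ∑ u, ∑ v, ∑ w, X u z * Y w v * (heis (-n) z u * heis n v w) := by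
    intro n
    simp only [Matrix.trace, Matrix.diag, Matrix.mul_apply, Finset.sum_mul]
    simp only [Finset.mul_sum]
    refine Finset.sum_congr rfl fun z _ => Finset.sum_congr rfl fun u _ =>
      Finset.sum_congr rfl fun v _ => Finset.sum_congr rfl fun w _ => by ring
  have h2 : ∀ z u, ∑ n : Fin 2 → ZMod N, ∑ v, ∑ w,
      X u z * Y w v * (heis (-n) z u * heis n v w) = X u z * Y z u * N := by
    intro z u
    rw [Finset.sum_comm]
    have h3 : ∀ v, ∑ n : Fin 2 → ZMod N, ∑ w,
        X u z * Y w v * (heis (-n) z u * heis n v w) =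
        if u = v then X u z * Y z v * N else 0 := by
      intro v
      rw [Finset.sum_comm]
      simp only [← Finset.mul_sum, sum_heis_entries hN]
      by_cases h : u = v <;> simp [h]
    simp only [h3, Finset.sum_ite_eq, Finset.mem_univ, if_true]
  simp only [h1]
  rw [Finset.sum_comm]
  calc ∑ z, ∑ n : Fin 2 → ZMod N, ∑ u, ∑ v, ∑ w,
        X u z * Y w v * (heis (-n) z u * heis n v w)
      = ∑ z, ∑ u, X u z * Y z u * N := by
        refine Finset.sum_congr rfl fun z _ => ?_
        rw [Finset.sum_comm]
        exact Finset.sum_congr rfl fun u _ => h2 z u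
    _ = _ := by
        rw [Finset.sum_comm]
        simp only [Matrix.trace, Matrix.diag, Matrix.mul_apply, Finset.mul_sum]
        exact Finset.sum_congr rfl fun z _ => Finset.sum_congr rfl fun u _ => by ring

/-- A matrix commuting with all Heisenberg matrices is scalar. -/
lemma eq_smul_one_of_commute_heis (hN : Odd N) (X : Matrix (ZMod N) (ZMod N) ℂ)
    (hX : ∀ n, Commute X (heis n)) : ∃ c : ℂ, X = c • 1 := by
  have hN0 : (N : ℂ) ≠ 0 := NeZero.ne _
  have h := sum_heis_conj hN X
  have h1 : ∀ n : Fin 2 → ZMod N, heis (-n) * X * heis n = X := fun n => by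
    rw [mul_assoc, (hX n).eq, ← mul_assoc, heis_neg_mul hN, one_mul]
  simp only [h1, Finset.sum_const, Finset.card_univ, Fintype.card_fun, Fintype.card_fin,
    ZMod.card] at h
  refine ⟨((N : ℂ) ^ 2)⁻¹ * (N * X.trace), ?_⟩
  rw [mul_smul, ← h, ← Nat.cast_smul_eq_nsmul ℂ, smul_smul]
  push_cast
  rw [inv_mul_cancel₀ (pow_ne_zero 2 hN0), one_smul]

/-- For $N=2m+1$ the inverse of $2$ is $m+1$, and $(m+1)/N=1/2+1/(2N)$. The sign thus converts a
$2N$-th root of unity into an $N$-th one, so the twisted operators depend only on $n$ modulo $N$. -/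
lemma neg_one_zpow_mul_exp_half (hN : Odd N) (j : ℤ) :
    (-1 : ℂ) ^ j * Complex.exp (2 * Real.pi * Complex.I * j / (2 * (N : ℂ)))
      = ZMod.stdAddChar ((j : ZMod N) * 2⁻¹) := by
  obtain ⟨m, hm⟩ := hN
  have hN0 : (N : ℂ) ≠ 0 := NeZero.ne _
  have h2 := two_mul_inv_two (N := N) ⟨m, hm⟩
  have hinv : (2 : ZMod N)⁻¹ = (((m + 1 : ℕ) : ℤ) : ZMod N) := by
    have h0 : (2 * m + 1 : ZMod N) = 0 := by
      have := ZMod.natCast_self N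
      rw [hm] at this ⊢; exact_mod_cast this
    push_cast
    linear_combination (m + 1 : ZMod N) * h2 - 2⁻¹ * h0
  rw [hinv, ← Int.cast_mul, ZMod.stdAddChar_coe, ← Complex.exp_pi_mul_I, ← Complex.exp_int_mul,
    ← Complex.exp_add]
  congr 1
  have hm' : (N : ℂ) = 2 * m + 1 := by rw [hm]; push_cast; ring
  push_cast
  field_simp
  rw [hm']; ring

lemma twistedOp_eq_toLin (hN : Odd N) (n : Fin 2 → ℤ) :
    twistedOp N n = Matrix.toLin' (heis (fun i => (n i : ZMod N))) := by
  ext1 y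
  refine LinearMap.ext fun c => ?_
  ext z
  have := neg_one_zpow_mul_exp_half hN (n 0 * n 1)
  push_cast at this
  simp only [twistedOp, elemOp, heis, LinearMap.comp_apply, LinearMap.smul_apply, Pi.smul_apply,
    smul_eq_mul, Matrix.toLin'_apply, Matrix.mulVec, dotProduct, ite_mul, zero_mul,
    Finset.sum_ite_eq', Finset.mem_univ, if_true, LinearMap.coe_mk,
    AddHom.coe_mk, AddChar.map_add_eq_mul]
  rw [← this]; ring

lemma elemOp_eq_smul_twistedOp (n : Fin 2 → ℤ) :
    elemOp N n = ((-1 : ℂ) ^ (n 0 * n 1)) • twistedOp N n := by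
  rw [twistedOp, smul_smul, ← mul_zpow]
  simp

end Heisenberg

/-! ### Existence of the quantum propagator -/

section Determinants

variable {V : Type*} [AddCommGroup V] [Module ℂ V]

open Classical in
/-- The determinant of `f` on an `f`-invariant subspace (and `1` if `p` is not invariant). -/
noncomputable def detOn (p : Submodule ℂ V) (f : Module.End ℂ V) : ℂ :=
  if h : ∀ x ∈ p, f x ∈ p then LinearMap.det (f.restrict h) else 1

lemma detOn_mul (p : Submodule ℂ V) {f g : Module.End ℂ V} (hf : ∀ x ∈ p, f x ∈ p)
    (hg : ∀ x ∈ p, g x ∈ p) : detOn p (f * g) = detOn p f * detOn p g := by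
  have hfg : ∀ x ∈ p, (f * g) x ∈ p := fun x hx => hf _ (hg x hx)
  rw [detOn, detOn, detOn, dif_pos hf, dif_pos hg, dif_pos hfg, ← LinearMap.det_comp]
  rfl

lemma detOn_smul (p : Submodule ℂ V) (c : ℂ) {f : Module.End ℂ V} (hf : ∀ x ∈ p, f x ∈ p) :
    detOn p (c • f) = c ^ Module.finrank ℂ p * detOn p f := by
  have hcf : ∀ x ∈ p, (c • f) x ∈ p := fun x hx => p.smul_mem c (hf x hx)
  rw [detOn, detOn, dif_pos hf, dif_pos hcf, ← LinearMap.det_smul]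
  rfl

lemma detOn_one (p : Submodule ℂ V) : detOn p (1 : Module.End ℂ V) = 1 := by
  rw [detOn, dif_pos (show ∀ x ∈ p, (1 : Module.End ℂ V) x ∈ p from fun x hx => hx)]
  exact LinearMap.det_id

end Determinants

/-! ### Intertwiners, parity and the choice of scalars. -/

section Propagator

open scoped ComplexOrder

lemma vecMul_inv_vecMul {N : ℕ} (B : SL(2, ZMod N)) (n : Fin 2 → ZMod N) :
    (n ᵥ* ((B⁻¹ : SL(2, ZMod N)) : Matrix (Fin 2) (Fin 2) (ZMod N))) ᵥ*
      (B : Matrix (Fin 2) (Fin 2) (ZMod N)) = n := by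
  rw [Matrix.vecMul_vecMul, ← Matrix.SpecialLinearGroup.coe_mul, inv_mul_cancel,
    Matrix.SpecialLinearGroup.coe_one, Matrix.vecMul_one]

variable {N : ℕ} [NeZero N]

/-- `V` implements the symplectic map `B` on the Heisenberg matrices. -/
def IsIntertwiner (B : SL(2, ZMod N)) (V : Matrix (ZMod N) (ZMod N) ℂ) : Prop :=
  ∀ n : Fin 2 → ZMod N,
    heis n * V = V * heis (n ᵥ* (B : Matrix (Fin 2) (Fin 2) (ZMod N)))

lemma IsIntertwiner.mul {B B' : SL(2, ZMod N)} {V V' : Matrix (ZMod N) (ZMod N) ℂ}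
    (h : IsIntertwiner B V) (h' : IsIntertwiner B' V') : IsIntertwiner (B * B') (V * V') := by
  intro n
  rw [← mul_assoc, h n, mul_assoc, h' _, ← mul_assoc, Matrix.vecMul_vecMul,
    Matrix.SpecialLinearGroup.coe_mul]

lemma IsIntertwiner.smul {B : SL(2, ZMod N)} {V : Matrix (ZMod N) (ZMod N) ℂ}
    (h : IsIntertwiner B V) (c : ℂ) : IsIntertwiner B (c • V) := by
  intro n
  rw [Matrix.mul_smul, h n, Matrix.smul_mul]

/-- Shift the summation index by $m$. The phases on the two sides are both $\omega(n,m)/2$, since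
$B$ preserves $\omega$. -/
lemma isIntertwiner_average (hN : Odd N) (B : SL(2, ZMod N)) (X : Matrix (ZMod N) (ZMod N) ℂ) :
    IsIntertwiner B (∑ n : Fin 2 → ZMod N,
      heis (-n) * X * heis (n ᵥ* (B : Matrix (Fin 2) (Fin 2) (ZMod N)))) := by
  intro m
  rw [Finset.mul_sum, Finset.sum_mul]
  refine Fintype.sum_equiv (Equiv.subRight m) _ _ fun n => ?_
  simp only [Equiv.subRight_apply]
  have h1 := heis_mul hN m (-n)
  have h2 := heis_mul hN ((n - m) ᵥ* (B : Matrix (Fin 2) (Fin 2) (ZMod N)))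
    (m ᵥ* (B : Matrix (Fin 2) (Fin 2) (ZMod N)))
  rw [← Matrix.add_vecMul, sympMod_vecMul, sub_add_cancel] at h2
  rw [← mul_assoc, ← mul_assoc, h1, mul_assoc (heis (-(n - m)) * X), h2, Matrix.smul_mul,
    Matrix.smul_mul, Matrix.mul_smul, neg_sub, ← sub_eq_add_neg]
  congr 3
  simp only [sympMod, Pi.neg_apply, Pi.sub_apply]; ring

/-- Suppose every average vanishes. The $(z,0)$ entries of the averages of the matrix units at
$(z,0)$, summed over $z$, give $\sum_n\mathrm{tr}\,T(-n)\cdot T(nB)_{00}$. Only $n=0$ survives, with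
value $N\ne0$. -/
lemma exists_isIntertwiner (hN : Odd N) (B : SL(2, ZMod N)) :
    ∃ V, V ≠ 0 ∧ IsIntertwiner B V := by
  by_contra! hcon
  have h0 : ∀ z : ZMod N, (∑ n : Fin 2 → ZMod N, heis (-n) * Matrix.single z 0 (1 : ℂ) *
      heis (n ᵥ* (B : Matrix (Fin 2) (Fin 2) (ZMod N)))) = 0 := fun z => by
    by_contra hV
    exact hcon _ hV (isIntertwiner_average hN B _)
  have hN0 : (N : ℂ) ≠ 0 := NeZero.ne _
  have hent : ∀ z : ZMod N, ∑ n : Fin 2 → ZMod N, heis (-n) z z *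
      heis (n ᵥ* (B : Matrix (Fin 2) (Fin 2) (ZMod N))) 0 0 = 0 := fun z => by
    have h := congrFun (congrFun (h0 z) z) 0
    rw [Matrix.sum_apply] at h
    simpa [Matrix.mul_apply, Matrix.single_apply, ite_and, Finset.sum_ite_eq] using h
  have hs : ∑ z : ZMod N, ∑ n : Fin 2 → ZMod N, heis (-n) z z *
      heis (n ᵥ* (B : Matrix (Fin 2) (Fin 2) (ZMod N))) 0 0 = 0 :=
    Finset.sum_eq_zero fun z _ => hent z
  rw [Finset.sum_comm] at hs
  have ht : ∀ n : Fin 2 → ZMod N, ∑ z : ZMod N, heis (-n) z z *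
      heis (n ᵥ* (B : Matrix (Fin 2) (Fin 2) (ZMod N))) 0 0 = if n = 0 then (N : ℂ) else 0 := by
    intro n
    rw [← Finset.sum_mul]
    have := trace_heis (-n)
    simp only [Matrix.trace, Matrix.diag, neg_eq_zero] at this
    rw [this]
    by_cases hn : n = 0
    · simp [hn, heis_zero]
    · simp [hn]
  simp only [ht, Finset.sum_ite_eq', Finset.mem_univ, if_true] at hs
  exact hN0 hs

/-- As $T(n)^*=T(-n)$, the product $V^*V$ commutes with every $T(nB)$, hence with every Heisenberg
matrix, and Schur's lemma applies. -/
lemma IsIntertwiner.conjTranspose_mul_self (hN : Odd N) {B : SL(2, ZMod N)}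
    {V : Matrix (ZMod N) (ZMod N) ℂ} (h : IsIntertwiner B V) : ∃ c : ℂ, Vᴴ * V = c • 1 := by
  refine eq_smul_one_of_commute_heis hN _ fun n => ?_
  obtain ⟨m, rfl⟩ : ∃ m, n = m ᵥ* (B : Matrix (Fin 2) (Fin 2) (ZMod N)) :=
    ⟨_, (vecMul_inv_vecMul B n).symm⟩
  have h1 := h m
  have h2 := congrArg Matrix.conjTranspose (h (-m))
  rw [Matrix.conjTranspose_mul, Matrix.conjTranspose_mul, heis_conjTranspose hN,
    heis_conjTranspose hN, neg_neg, Matrix.neg_vecMul, neg_neg] at h2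
  rw [Commute, SemiconjBy, mul_assoc, ← h1, ← mul_assoc, h2, mul_assoc]

lemma IsIntertwiner.exists_inverse (hN : Odd N) {B : SL(2, ZMod N)}
    {V : Matrix (ZMod N) (ZMod N) ℂ} (h : IsIntertwiner B V) (hV : V ≠ 0) :
    ∃ V', V * V' = 1 ∧ V' * V = 1 := by
  obtain ⟨c, hc⟩ := h.conjTranspose_mul_self hN
  have hc0 : c ≠ 0 := by
    rintro rfl
    rw [zero_smul, Matrix.conjTranspose_mul_self_eq_zero] at hc
    exact hV hc
  have h1 : (c⁻¹ • Vᴴ) * V = 1 := by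
    rw [Matrix.smul_mul, hc, smul_smul, inv_mul_cancel₀ hc0, one_smul]
  exact ⟨c⁻¹ • Vᴴ, mul_eq_one_comm.mp h1, h1⟩

lemma IsIntertwiner.inverse {B : SL(2, ZMod N)} {V V' : Matrix (ZMod N) (ZMod N) ℂ}
    (h : IsIntertwiner B V) (h1 : V * V' = 1) (h2 : V' * V = 1) : IsIntertwiner B⁻¹ V' := by
  intro n
  have := h (n ᵥ* ((B⁻¹ : SL(2, ZMod N)) : Matrix (Fin 2) (Fin 2) (ZMod N)))
  rw [vecMul_inv_vecMul] at this
  calc heis n * V' = V' * V * heis n * V' := by rw [h2, one_mul]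
    _ = V' * (V * heis n) * V' := by simp only [mul_assoc]
    _ = V' * heis (n ᵥ* ((B⁻¹ : SL(2, ZMod N)) : Matrix (Fin 2) (Fin 2) (ZMod N))) *
        (V * V') := by rw [← this]; simp only [mul_assoc]
    _ = _ := by rw [h1, mul_one]

lemma IsIntertwiner.eq_smul (hN : Odd N) {B : SL(2, ZMod N)}
    {V W : Matrix (ZMod N) (ZMod N) ℂ} (h : IsIntertwiner B V) (hV : V ≠ 0)
    (h' : IsIntertwiner B W) : ∃ c : ℂ, W = c • V := by
  obtain ⟨V', h1, h2⟩ := h.exists_inverse hN hV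
  have h3 := (h.inverse h1 h2).mul h'
  rw [inv_mul_cancel] at h3
  obtain ⟨c, hc⟩ := eq_smul_one_of_commute_heis hN (V' * W) fun n => by
    have := h3 n
    rw [Matrix.SpecialLinearGroup.coe_one, Matrix.vecMul_one] at this
    exact this.symm
  refine ⟨c, ?_⟩
  rw [← one_mul W, ← h1, mul_assoc, hc, Matrix.mul_smul, mul_one]

/-- The parity matrix `ψ(y) ↦ ψ(-y)`. -/
def parity (N : ℕ) [NeZero N] : Matrix (ZMod N) (ZMod N) ℂ :=
  fun y z => if z = -y then 1 else 0

lemma parity_mul_self : parity N * parity N = 1 := by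
  ext y z
  rw [Matrix.mul_apply, Finset.sum_eq_single (-y) (fun j _ hj => by simp [parity, hj]) (by simp)]
  simp [parity, Matrix.one_apply, eq_comm]

lemma heis_mul_parity (n : Fin 2 → ZMod N) : heis n * parity N = parity N * heis (-n) := by
  ext y z
  rw [Matrix.mul_apply, Matrix.mul_apply,
    Finset.sum_eq_single (y + n 0) (fun j _ hj => by simp [heis, hj]) (by simp),
    Finset.sum_eq_single (-y) (fun j _ hj => by simp [parity, hj]) (by simp)]
  simp only [heis, parity, if_true, Pi.neg_apply, mul_ite, mul_one, mul_zero, one_mul, neg_add,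
    neg_mul_neg]

lemma trace_parity (hN : Odd N) : (parity N).trace = 1 := by
  have h2 := two_mul_inv_two hN
  have : ∀ y : ZMod N, y = -y ↔ y = 0 := fun y => by
    constructor
    · intro h; linear_combination (-y) * h2 + 2⁻¹ * h
    · rintro rfl; simp
  simp [Matrix.trace, parity, this]

/-- Parity implements the central element $-1$, so $VPV^{-1}$ also implements $-1$ and is a multiple
of $P$. Comparing traces, with $\mathrm{tr}\,P=1$, shows that the multiple is $1$. -/
lemma IsIntertwiner.commute_parity (hN : Odd N) {B : SL(2, ZMod N)}
    {V : Matrix (ZMod N) (ZMod N) ℂ} (h : IsIntertwiner B V) : V * parity N = parity N * V := by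
  by_cases hV : V = 0
  · simp [hV]
  obtain ⟨V', h1, h2⟩ := h.exists_inverse hN hV
  have hP : IsIntertwiner (-1 : SL(2, ZMod N)) (parity N) := fun n => by
    rw [heis_mul_parity, Matrix.SpecialLinearGroup.coe_neg, Matrix.vecMul_neg,
      Matrix.SpecialLinearGroup.coe_one, Matrix.vecMul_one]
  have h3 := (h.mul hP).mul (h.inverse h1 h2)
  rw [mul_neg_one, neg_mul, mul_inv_cancel] at h3
  have hP0 : parity N ≠ 0 := fun h0 => by
    have := trace_parity hN
    simp [h0] at this
  obtain ⟨c, hc⟩ := hP.eq_smul hN hP0 h3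
  have htr := congrArg Matrix.trace hc
  rw [Matrix.trace_smul, Matrix.trace_mul_comm, ← mul_assoc, h2, one_mul, trace_parity hN,
    smul_eq_mul, mul_one] at htr
  rw [← htr, one_smul] at hc
  calc V * parity N = V * parity N * V' * V := by rw [mul_assoc _ V', h2, mul_one]
    _ = _ := by rw [hc]

/-- The even (`s = 1`) or odd (`s = -1`) states. -/
noncomputable def paritySpace (N : ℕ) [NeZero N] (s : ℂ) : Submodule ℂ (State N) :=
  LinearMap.ker (Matrix.toLin' (parity N) - s • LinearMap.id)

lemma mem_paritySpace (s : ℂ) (ψ : State N) :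
    ψ ∈ paritySpace N s ↔ parity N *ᵥ ψ = s • ψ := by
  simp [paritySpace, sub_eq_zero]

/-- The dimension is the trace of the projection $(1+sP)/2$. -/
lemma finrank_paritySpace (hN : Odd N) (s : ℂ) (hs : s * s = 1) :
    (Module.finrank ℂ (paritySpace N s) : ℂ) = (N + s) / 2 := by
  have hproj : LinearMap.IsProj (paritySpace N s)
      (Matrix.toLin' ((1 / 2 : ℂ) • (1 + s • parity N))) := by
    constructor
    · intro ψ
      rw [mem_paritySpace, Matrix.toLin'_apply, Matrix.mulVec_mulVec, ← Matrix.smul_mulVec]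
      congr 1
      rw [Matrix.mul_smul, mul_add, mul_one, Matrix.mul_smul, parity_mul_self, smul_comm s,
        smul_add s, smul_smul s s, hs, one_smul, add_comm]
    · intro ψ hψ
      rw [mem_paritySpace] at hψ
      rw [Matrix.toLin'_apply, Matrix.smul_mulVec, Matrix.add_mulVec, Matrix.one_mulVec,
        Matrix.smul_mulVec, hψ, smul_smul, hs, one_smul, ← two_smul ℂ, smul_smul]
      norm_num
  rw [← hproj.trace, Matrix.trace_toLin'_eq, Matrix.trace_smul, Matrix.trace_add,
    Matrix.trace_smul, trace_parity hN, Matrix.trace_one, ZMod.card]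
  simp only [smul_eq_mul]; ring

lemma finrank_even_eq (hN : Odd N) :
    Module.finrank ℂ (paritySpace N 1) = Module.finrank ℂ (paritySpace N (-1)) + 1 := by
  have h1 := finrank_paritySpace hN 1 (by ring)
  have h2 := finrank_paritySpace hN (-1) (by ring)
  have : ((Module.finrank ℂ (paritySpace N 1) : ℕ) : ℂ) =
      ((Module.finrank ℂ (paritySpace N (-1)) + 1 : ℕ) : ℂ) := by
    push_cast; rw [h1, h2]; ring
  exact_mod_cast this

lemma paritySpace_invariant (s : ℂ) {V : Matrix (ZMod N) (ZMod N) ℂ}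
    (hV : V * parity N = parity N * V) :
    ∀ ψ ∈ paritySpace N s, Matrix.toLin' V ψ ∈ paritySpace N s := by
  intro ψ hψ
  rw [mem_paritySpace] at hψ ⊢
  rw [Matrix.toLin'_apply, Matrix.mulVec_mulVec, ← hV, ← Matrix.mulVec_mulVec, hψ,
    Matrix.mulVec_smul]

/-- The scale-invariant normalization of a matrix commuting with parity: as the even and odd
subspaces have dimensions that differ by one, the ratio of the determinants on them cancels any
scalar factor. -/
noncomputable def normalize (V : Matrix (ZMod N) (ZMod N) ℂ) : Matrix (ZMod N) (ZMod N) ℂ :=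
  (detOn (paritySpace N (-1)) (Matrix.toLin' V) / detOn (paritySpace N 1) (Matrix.toLin' V)) • V

lemma normalize_mul {V W : Matrix (ZMod N) (ZMod N) ℂ} (hV : V * parity N = parity N * V)
    (hW : W * parity N = parity N * W) : normalize (V * W) = normalize V * normalize W := by
  have h : Matrix.toLin' (V * W) = (Matrix.toLin' V : Module.End ℂ (State N)) *
    Matrix.toLin' W := Matrix.toLin'_mul V W
  rw [normalize, normalize, normalize, h,
    detOn_mul _ (paritySpace_invariant _ hV) (paritySpace_invariant _ hW),
    detOn_mul _ (paritySpace_invariant _ hV) (paritySpace_invariant _ hW),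
    Matrix.smul_mul, Matrix.mul_smul, smul_smul, mul_div_mul_comm]

lemma normalize_smul (hN : Odd N) {V : Matrix (ZMod N) (ZMod N) ℂ}
    (hV : V * parity N = parity N * V) {c : ℂ} (hc : c ≠ 0) :
    normalize (c • V) = normalize V := by
  have h : Matrix.toLin' (c • V) = c • (Matrix.toLin' V : Module.End ℂ (State N)) :=
    map_smul _ _ _
  rw [normalize, normalize, h, detOn_smul _ _ (paritySpace_invariant _ hV),
    detOn_smul _ _ (paritySpace_invariant _ hV), smul_smul, finrank_even_eq hN]
  congr 1
  rw [pow_succ]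
  field_simp

lemma normalize_one : normalize (1 : Matrix (ZMod N) (ZMod N) ℂ) = 1 := by
  have h : Matrix.toLin' (1 : Matrix (ZMod N) (ZMod N) ℂ) = (1 : Module.End ℂ (State N)) :=
    Matrix.toLin'_one
  rw [normalize, h, detOn_one, detOn_one, div_one, one_smul]

lemma IsIntertwiner.commute_one_eq (hN : Odd N) {V : Matrix (ZMod N) (ZMod N) ℂ}
    (h : IsIntertwiner 1 V) : ∃ c : ℂ, V = c • 1 :=
  eq_smul_one_of_commute_heis hN V fun n => by
    have := h n
    rw [Matrix.SpecialLinearGroup.coe_one, Matrix.vecMul_one] at this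
    exact this.symm

/-- The Weil representation, as a homomorphism to matrices. -/
theorem exists_weil_matrix (hN : Odd N) :
    ∃ M : SL(2, ZMod N) →* Matrix (ZMod N) (ZMod N) ℂ, ∀ B, IsIntertwiner B (M B) := by
  choose V hV0 hV using exists_isIntertwiner (N := N) hN
  have hP := fun B => (hV B).commute_parity hN
  refine ⟨⟨⟨fun B => normalize (V B), ?_⟩, ?_⟩, fun B => (hV B).smul _⟩
  · obtain ⟨c, hc⟩ := (hV 1).commute_one_eq hN
    have hc0 : c ≠ 0 := by
      rintro rfl
      exact hV0 1 (by rw [hc, zero_smul])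
    change normalize (V 1) = 1
    rw [hc, normalize_smul hN (by simp) hc0, normalize_one]
  · intro B B'
    change normalize (V (B * B')) = normalize (V B) * normalize (V B')
    -- The two intertwiners of $BB'$ differ by a nonzero scalar, which `normalize` does not see.
    obtain ⟨c, hc⟩ := (hV (B * B')).eq_smul hN (hV0 _) ((hV B).mul (hV B'))
    have hc0 : c ≠ 0 := by
      rintro rfl
      rw [zero_smul] at hc
      obtain ⟨W, hW, hW'⟩ := (hV B).exists_inverse hN (hV0 B)
      apply hV0 B'
      rw [← one_mul (V B'), ← hW', mul_assoc, hc, mul_zero]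
    rw [← normalize_mul (hP B) (hP B'), hc, normalize_smul hN (hP _) hc0]

/-- The scalars $c(B)$ in $M(B)^*M(B)=c(B)$ are nonnegative reals and multiplicative in $B$. On a
finite group they are roots of unity, hence $1$. -/
lemma weil_matrix_unitary (hN : Odd N) (M : SL(2, ZMod N) →* Matrix (ZMod N) (ZMod N) ℂ)
    (hM : ∀ B, IsIntertwiner B (M B)) (B : SL(2, ZMod N)) : (M B)ᴴ * M B = 1 := by
  choose c hc using fun B => (hM B).conjTranspose_mul_self hN
  have hent : ∀ (a b : ℂ), a • (1 : Matrix (ZMod N) (ZMod N) ℂ) = b • 1 → a = b := by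
    intro a b h
    simpa using congrFun (congrFun h 0) 0
  have hmul : ∀ B B', c (B * B') = c B * c B' := fun B B' => by
    apply hent
    rw [← hc, map_mul, Matrix.conjTranspose_mul, mul_assoc, ← mul_assoc (M B)ᴴ, hc,
      Matrix.smul_mul, one_mul, Matrix.mul_smul, hc, smul_smul]
  have hone : c 1 = 1 := by
    apply hent
    rw [← hc, map_one]; simp
  let φ : SL(2, ZMod N) →* ℂ := ⟨⟨c, hone⟩, hmul⟩
  have hnn : ∃ r : ℝ, 0 ≤ r ∧ c B = r := by
    refine ⟨∑ z, Complex.normSq (M B z 0), Finset.sum_nonneg fun z _ => Complex.normSq_nonneg _, ?_⟩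
    have := congrFun (congrFun (hc B) 0) 0
    simp only [Matrix.mul_apply, Matrix.conjTranspose_apply, Matrix.smul_apply,
      Matrix.one_apply_eq, smul_eq_mul, mul_one, RCLike.star_def] at this
    rw [← this]
    push_cast
    exact Finset.sum_congr rfl fun z _ => by rw [Complex.normSq_eq_conj_mul_self]
  obtain ⟨r, hr0, hr⟩ := hnn
  have hfin : c B ^ Nat.card SL(2, ZMod N) = 1 := by
    have : φ (B ^ Nat.card SL(2, ZMod N)) = 1 := by rw [pow_card_eq_one', map_one]
    rw [map_pow] at this
    exact this
  rw [hr] at hfin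
  have hr1 : r = 1 := by
    have : r ^ Nat.card SL(2, ZMod N) = 1 := by exact_mod_cast hfin
    exact (pow_eq_one_iff_of_nonneg hr0 Nat.card_pos.ne').mp this
  rw [hc, hr, hr1]; simp

theorem exists_isPropagator (hN : Odd N) :
    ∃ U : SL(2, ZMod N) →* Module.End ℂ (State N), IsPropagator N U := by
  obtain ⟨M, hM⟩ := exists_weil_matrix (N := N) hN
  refine ⟨(Matrix.toLinAlgEquiv' (R := ℂ) (n := ZMod N)).toMonoidHom.comp M, ⟨?_, ?_⟩⟩
  · intro B φ ψ
    have h1 : ∀ φ, ((Matrix.toLinAlgEquiv' (R := ℂ) (n := ZMod N)).toMonoidHom.comp M) B φ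
      = M B *ᵥ φ := fun φ => rfl
    rw [h1, h1]
    have h2 : ∀ φ ψ : State N, ∑ y, φ y * conj (ψ y) = star ψ ⬝ᵥ φ := fun φ ψ => by
      simp [dotProduct, mul_comm]
    rw [braket, braket, h2, h2, Matrix.star_mulVec, ← Matrix.dotProduct_mulVec,
      Matrix.mulVec_mulVec, weil_matrix_unitary hN M hM, Matrix.one_mulVec]
  · intro B n m h
    rw [twistedOp_eq_toLin hN, twistedOp_eq_toLin hN, h]
    change Matrix.toLin' (M B⁻¹) * Matrix.toLin' _ * Matrix.toLin' (M B) = _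
    rw [Module.End.mul_eq_comp, Module.End.mul_eq_comp, ← Matrix.toLin'_mul, ← Matrix.toLin'_mul,
      mul_assoc, hM B, ← mul_assoc, ← map_mul, inv_mul_cancel, map_one, one_mul]

end Propagator

/-! ### Joint eigenspaces of finite commutative groups -/

section Characters

variable {G : Type*} [Group G] [Fintype G]

/-- Commutativity is a hypothesis and not an instance, because the Hecke group is a centralizer that
is shown to be commutative only when $D$ is a unit. -/
lemma card_dual (hG : ∀ a b : G, a * b = b * a) : Nat.card (G →* ℂˣ) = Fintype.card G := by
  let : CommGroup G := { ‹Group G› with mul_comm := hG }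
  rw [← Nat.card_eq_fintype_card]
  exact CommGroup.card_monoidHom_of_hasEnoughRootsOfUnity G ℂ

lemma finite_dual (hG : ∀ a b : G, a * b = b * a) : Finite (G →* ℂˣ) :=
  Nat.finite_of_card_ne_zero (by rw [card_dual hG]; exact Fintype.card_ne_zero)

lemma sum_dual_apply [DecidableEq G] (hG : ∀ a b : G, a * b = b * a) [Fintype (G →* ℂˣ)] (g : G) :
    ∑ χ : G →* ℂˣ, (χ g : ℂ) = if g = 1 then (Fintype.card G : ℂ) else 0 := by
  split_ifs with h
  · subst h
    have := card_dual hG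
    rw [Nat.card_eq_fintype_card] at this
    simp [this]
  · obtain ⟨φ, hφ⟩ : ∃ φ : G →* ℂˣ, φ g ≠ 1 := by
      let : CommGroup G := { ‹Group G› with mul_comm := hG }
      exact CommGroup.exists_apply_ne_one_of_hasEnoughRootsOfUnity G ℂ h
    have h1 : ∑ χ : G →* ℂˣ, (χ g : ℂ) = ∑ χ : G →* ℂˣ, (φ g : ℂ) * χ g := by
      rw [← Fintype.sum_equiv (Equiv.mulLeft φ) (fun χ => ((φ * χ) g : ℂ)) _ (fun χ => rfl)]
      simp
    rw [← Finset.mul_sum] at h1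
    have h2 : ((φ g : ℂ) - 1) * ∑ χ : G →* ℂˣ, (χ g : ℂ) = 0 := by linear_combination -h1
    refine (mul_eq_zero.mp h2).resolve_left ?_
    rw [sub_eq_zero, Units.val_eq_one]
    exact hφ

variable {V : Type*} [AddCommGroup V] [Module ℂ V]

/-- The joint eigenspace of a representation for a character. -/
def jointEigenspace (ρ : G →* Module.End ℂ V) (χ : G →* ℂˣ) : Submodule ℂ V where
  carrier := {v | ∀ g, ρ g v = (χ g : ℂ) • v}
  add_mem' hu hv g := by rw [map_add, hu g, hv g, smul_add]
  zero_mem' g := by simp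
  smul_mem' c v hv g := by rw [map_smul, hv g, smul_comm]

/-- The projection to the joint eigenspace. -/
noncomputable def jointProj (ρ : G →* Module.End ℂ V) (χ : G →* ℂˣ) : Module.End ℂ V :=
  (Fintype.card G : ℂ)⁻¹ • ∑ g, (χ g : ℂ) • ρ g⁻¹

lemma isProj_jointProj (ρ : G →* Module.End ℂ V) (χ : G →* ℂˣ) :
    LinearMap.IsProj (jointEigenspace ρ χ) (jointProj ρ χ) := by
  have hc : (Fintype.card G : ℂ) ≠ 0 := Nat.cast_ne_zero.mpr Fintype.card_ne_zero
  constructor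
  · intro v g
    simp only [jointProj, LinearMap.smul_apply, LinearMap.sum_apply, map_smul, map_sum]
    rw [smul_comm]
    congr 1
    rw [Finset.smul_sum]
    refine Fintype.sum_equiv (Equiv.mulRight g⁻¹) _ _ fun h => ?_
    simp only [Equiv.coe_mulRight, ← Module.End.mul_apply, ← map_mul, smul_smul, _root_.mul_inv_rev,
      inv_inv]
    congr 1
    rw [map_mul, map_inv]
    push_cast
    rw [mul_comm (χ h : ℂ), mul_inv_cancel_left₀ (Units.ne_zero _)]
  · intro v hv
    have h1 : ∀ g, (χ g : ℂ) • ρ g⁻¹ v = v := fun g => by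
      rw [hv g⁻¹, smul_smul, map_inv]
      simp
    simp only [jointProj, LinearMap.smul_apply, LinearMap.sum_apply, h1, Finset.sum_const,
      Finset.card_univ]
    rw [← Nat.cast_smul_eq_nsmul ℂ, smul_smul, inv_mul_cancel₀ hc, one_smul]

variable [FiniteDimensional ℂ V]

lemma finrank_jointEigenspace (ρ : G →* Module.End ℂ V) (χ : G →* ℂˣ) :
    (Module.finrank ℂ (jointEigenspace ρ χ) : ℂ) =
      (Fintype.card G : ℂ)⁻¹ * ∑ g, (χ g : ℂ) * LinearMap.trace ℂ V (ρ g⁻¹) := by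
  rw [← (isProj_jointProj ρ χ).trace, jointProj]
  simp [map_sum]

lemma sum_finrank_jointEigenspace (hG : ∀ a b : G, a * b = b * a) [Fintype (G →* ℂˣ)]
    (ρ : G →* Module.End ℂ V) :
    ∑ χ : G →* ℂˣ, (Module.finrank ℂ (jointEigenspace ρ χ) : ℂ) = Module.finrank ℂ V := by
  classical
  have hc : (Fintype.card G : ℂ) ≠ 0 := Nat.cast_ne_zero.mpr Fintype.card_ne_zero
  simp only [finrank_jointEigenspace]
  rw [← Finset.mul_sum, Finset.sum_comm]
  simp only [← Finset.sum_mul, sum_dual_apply hG, ite_mul, zero_mul, Finset.sum_ite_eq',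
    Finset.mem_univ, if_true, inv_one, map_one, LinearMap.trace_one]
  rw [inv_mul_cancel_left₀ hc]

/-- Parseval on the dual group: the multiplicities are the Fourier coefficients of the trace. -/
lemma sum_finrank_sq_jointEigenspace (hG : ∀ a b : G, a * b = b * a) [Fintype (G →* ℂˣ)]
    (ρ : G →* Module.End ℂ V) :
    ∑ χ : G →* ℂˣ, (Module.finrank ℂ (jointEigenspace ρ χ) : ℂ) ^ 2 =
      (Fintype.card G : ℂ)⁻¹ *
        ∑ g, LinearMap.trace ℂ V (ρ g) * LinearMap.trace ℂ V (ρ g⁻¹) := by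
  classical
  have hc : (Fintype.card G : ℂ) ≠ 0 := Nat.cast_ne_zero.mpr Fintype.card_ne_zero
  have h1 : ∀ χ : G →* ℂˣ, (Module.finrank ℂ (jointEigenspace ρ χ) : ℂ) ^ 2 =
      ∑ g, ∑ h, (Fintype.card G : ℂ)⁻¹ ^ 2 * (LinearMap.trace ℂ V (ρ g⁻¹) *
        LinearMap.trace ℂ V (ρ h⁻¹)) * (χ (h * g) : ℂ) := fun χ => by
    rw [finrank_jointEigenspace, mul_pow, sq (∑ g, _), Finset.sum_mul_sum, Finset.mul_sum]
    refine Finset.sum_congr rfl fun g _ => ?_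
    rw [Finset.mul_sum]
    refine Finset.sum_congr rfl fun h _ => ?_
    rw [map_mul]; push_cast; ring
  simp only [h1]
  rw [Finset.sum_comm, Finset.mul_sum]
  refine Finset.sum_congr rfl fun g _ => ?_
  rw [Finset.sum_comm]
  simp only [← Finset.mul_sum, sum_dual_apply hG, mul_eq_one_iff_eq_inv, mul_ite, mul_zero,
    Finset.sum_ite_eq', Finset.mem_univ, if_true, inv_inv]
  field_simp

/-- All but few characters have multiplicity one, if the mean square of the trace is small. -/
lemma card_mult_ne_one_le (hG : ∀ a b : G, a * b = b * a) (ρ : G →* Module.End ℂ V) (S : ℝ)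
    (hS : ∑ g, LinearMap.trace ℂ V (ρ g) * LinearMap.trace ℂ V (ρ g⁻¹) = (S : ℂ)) :
    ({χ : G →* ℂˣ | Module.finrank ℂ (jointEigenspace ρ χ) ≠ 1}.ncard : ℝ) ≤
      S / Fintype.card G - 2 * Module.finrank ℂ V + Fintype.card G := by
  classical
  have := finite_dual hG
  let : Fintype (G →* ℂˣ) := Fintype.ofFinite _
  set d : (G →* ℂˣ) → ℕ := fun χ => Module.finrank ℂ (jointEigenspace ρ χ) with hd
  have h1 : ∑ χ, (d χ : ℝ) = Module.finrank ℂ V := by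
    have := sum_finrank_jointEigenspace hG ρ
    exact_mod_cast this
  have h2 : ∑ χ, (d χ : ℝ) ^ 2 = S / Fintype.card G := by
    have := sum_finrank_sq_jointEigenspace hG ρ
    rw [hS] at this
    rw [div_eq_inv_mul]
    apply Complex.ofReal_injective
    push_cast
    exact this
  -- An integer $d\ne1$ has $(d-1)^2\ge1$, so this sum bounds the number of exceptional characters.
  have h3 : ∑ χ, ((d χ : ℝ) - 1) ^ 2 =
      S / Fintype.card G - 2 * Module.finrank ℂ V + Fintype.card G := by
    have hcard := card_dual hG
    rw [Nat.card_eq_fintype_card] at hcard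
    rw [← h1, ← h2, ← hcard]
    simp only [sub_sq, Finset.sum_add_distrib, Finset.sum_sub_distrib, Finset.mul_sum]
    simp
  rw [← h3, Set.ncard_eq_toFinset_card', Finset.card_eq_sum_ones, Nat.cast_sum]
  calc ∑ χ ∈ {χ | d χ ≠ 1}.toFinset, ((1 : ℕ) : ℝ)
      ≤ ∑ χ ∈ {χ | d χ ≠ 1}.toFinset, ((d χ : ℝ) - 1) ^ 2 := by
        refine Finset.sum_le_sum fun χ hχ => ?_
        simp only [Set.mem_toFinset, Set.mem_ofPred_eq] at hχ
        have : (1 : ℤ) ≤ ((d χ : ℤ) - 1) ^ 2 := by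
          have : (d χ : ℤ) - 1 ≠ 0 := by omega
          have := sq_pos_of_ne_zero this
          omega
        exact_mod_cast this
    _ ≤ _ := Finset.sum_le_univ_sum_of_nonneg fun χ => sq_nonneg _

end Characters

/-- Extension of a function that is multiplicative off a subgroup `K`. -/
lemma exists_monoidHom_eq_off_subgroup {G M : Type*} [Group G] [CommGroup M]
    (hG : ∀ a b : G, a * b = b * a)
    (K : Subgroup G) (c : G) (hc : c ∉ K) (hcc : c * c = 1) (f : G → M) (hfc : f c * f c = 1)
    (h1 : ∀ a b, a ∉ K → b ∉ K → a * b ∉ K → f a * f b = f (a * b))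
    (h2 : ∀ a b, a ∉ K → b ∉ K → a * b ∈ K → f a * f b = f c * f (c * (a * b))) :
    ∃ χ : G →* M, ∀ g, g ∉ K → χ g = f g := by
  classical
  let : CommGroup G := { ‹Group G› with mul_comm := hG }
  -- The values on $K$ are forced by $g=c\cdot(cg)$, where both factors lie outside $K$.
  set F : G → M := fun g => if g ∈ K then f c * f (c * g) else f g with hF
  have hFK : ∀ g ∈ K, F g = f c * f (c * g) := fun g hg => if_pos hg
  have hFn : ∀ g, g ∉ K → F g = f g := fun g hg => if_neg hg
  have hcK : ∀ g ∈ K, c * g ∉ K := fun g hg h => hc ((K.mul_mem_cancel_right hg).mp h)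
  have h3 : ∀ a b, a ∉ K → b ∉ K → f a * f b = F (a * b) := fun a b ha hb => by
    by_cases hab : a * b ∈ K
    · rw [hFK _ hab, h2 a b ha hb hab]
    · rw [hFn _ hab, h1 a b ha hb hab]
  -- Write $b=c\cdot(cb)$. If $ca\notin K$, then $f(a)f(c)=f(ca)$ and `h3` finishes. If $ca\in K$,
  -- then $a\cdot cb\in K$, and the definition of $F$ there produces a second $f(c)$, cancelled by
  -- $f(c)^2=1$.
  have h4 : ∀ a b, a ∉ K → b ∈ K → F a * F b = F (a * b) := fun a b ha hb => by
    rw [hFn a ha, hFK b hb]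
    have hab : a * b ∉ K := fun h => ha ((K.mul_mem_cancel_right hb).mp h)
    by_cases hca : c * a ∈ K
    · have h5 := h3 a (c * b) ha (hcK b hb)
      have h6 : a * (c * b) = c * a * b := by rw [← mul_assoc, mul_comm a c]
      rw [h6, hFK _ (K.mul_mem hca hb), mul_assoc c a, ← mul_assoc c c, hcc, one_mul] at h5
      rw [hFn _ hab, mul_left_comm, h5, ← mul_assoc, hfc, one_mul]
    · rw [← mul_assoc, mul_comm (f a), h1 c a hc ha hca, h3 _ _ hca (hcK b hb)]
      congr 1
      rw [mul_mul_mul_comm, hcc, one_mul]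
  refine ⟨MonoidHom.mk' F fun a b => ?_, fun g hg => hFn g hg⟩
  symm
  by_cases ha : a ∈ K <;> by_cases hb : b ∈ K
  · rw [hFK a ha, hFK b hb, mul_mul_mul_comm, hfc, one_mul, h3 _ _ (hcK a ha) (hcK b hb)]
    congr 1
    rw [mul_mul_mul_comm, hcc, one_mul]
  · rw [mul_comm, h4 b a hb ha, mul_comm b a]
  · exact h4 a b ha hb
  · rw [hFn a ha, hFn b hb, h3 a b ha hb]

/-! ### Structure of the Hecke group -/

section HeckeAlgebra

variable (A : SL(2, ℤ)) {N : ℕ}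

lemma sqrtDisc_eq (N : ℕ) : sqrtDisc A N =
    !![(A 0 0 : ZMod N) - A 1 1, 2 * A 0 1; 2 * A 1 0, (A 1 1 : ZMod N) - A 0 0] := by
  have e : ∀ i j, (red A N : Matrix (Fin 2) (Fin 2) (ZMod N)) i j = ((A i j : ℤ) : ZMod N) :=
    fun i j => rfl
  ext i j
  fin_cases i <;> fin_cases j <;>
    simp [sqrtDisc, Matrix.SpecialLinearGroup.coe_inv, Matrix.adjugate_fin_two, e] <;> ring

lemma disc_cast (N : ℕ) : (disc A : ZMod N) =
    ((A 0 0 : ZMod N) - A 1 1) ^ 2 + 4 * (A 0 1 * A 1 0) := by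
  have h := A.2
  rw [Matrix.det_fin_two] at h
  have h' : ((A 0 0 * A 1 1 - A 0 1 * A 1 0 : ℤ) : ZMod N) = 1 := by rw [h]; simp
  push_cast at h'
  simp only [disc, Matrix.trace_fin_two]
  push_cast
  linear_combination (4 : ZMod N) * h'

lemma sqrtDisc_mul_self (N : ℕ) :
    sqrtDisc A N * sqrtDisc A N = (disc A : ZMod N) • (1 : Matrix (Fin 2) (Fin 2) (ZMod N)) := by
  rw [disc_cast, sqrtDisc_eq]
  ext i j
  fin_cases i <;> fin_cases j <;> simp [Matrix.mul_apply, Fin.sum_univ_two] <;> ring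

/-- The element `a + b √D` of the Hecke algebra. -/
def heckeElt (a b : ZMod N) : Matrix (Fin 2) (Fin 2) (ZMod N) :=
  a • (1 : Matrix (Fin 2) (Fin 2) (ZMod N)) + b • sqrtDisc A N

lemma heckeElt_mul (a b c d : ZMod N) : heckeElt A a b * heckeElt A c d =
    heckeElt A (a * c + (disc A : ZMod N) * (b * d)) (a * d + b * c) := by
  simp only [heckeElt, add_mul, mul_add, Matrix.smul_mul, Matrix.mul_smul, one_mul, mul_one,
    sqrtDisc_mul_self, smul_smul, add_smul]
  module

lemma heckeElt_one_zero : heckeElt A (1 : ZMod N) 0 = 1 := by simp [heckeElt]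

lemma heckeElt_neg (a b : ZMod N) : -heckeElt A a b = heckeElt A (-a) (-b) := by
  simp [heckeElt, add_comm]

lemma det_heckeElt (a b : ZMod N) : (heckeElt A a b).det = a ^ 2 - (disc A : ZMod N) * b ^ 2 := by
  rw [disc_cast, heckeElt, sqrtDisc_eq, Matrix.det_fin_two]
  simp
  ring

lemma trace_heckeElt (a b : ZMod N) : (heckeElt A a b).trace = 2 * a := by
  rw [heckeElt, sqrtDisc_eq, Matrix.trace_fin_two]
  simp
  ring

lemma commute_red_sqrtDisc :
    Commute (red A N : Matrix (Fin 2) (Fin 2) (ZMod N)) (sqrtDisc A N) := by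
  refine (Commute.refl _).sub_right ?_
  exact congrArg Subtype.val (Commute.refl (red A N)).inv_right

lemma commute_red_heckeElt (a b : ZMod N) :
    Commute (red A N : Matrix (Fin 2) (Fin 2) (ZMod N)) (heckeElt A a b) :=
  ((Commute.one_right _).smul_right a).add_right ((commute_red_sqrtDisc A).smul_right b)

lemma heckeElt_injective (hN : Odd N) (hD : IsUnit (disc A : ZMod N)) {a b c d : ZMod N}
    (h : heckeElt A a b = heckeElt A c d) :
    a = c ∧ b = d := by
  have h2 := two_mul_inv_two hN
  have h1 := congrArg Matrix.trace h
  rw [trace_heckeElt, trace_heckeElt] at h1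
  have hac : a = c := by linear_combination (c - a) * h2 + 2⁻¹ * h1
  refine ⟨hac, ?_⟩
  subst hac
  have h3 : b • sqrtDisc A N = d • sqrtDisc A N := add_left_cancel h
  have h4 := congrArg (fun X => (X * sqrtDisc A N) 0 0) h3
  simp only [Matrix.smul_mul, sqrtDisc_mul_self, Matrix.smul_apply, Matrix.one_apply_eq,
    smul_eq_mul, mul_one] at h4
  exact hD.mul_right_cancel h4

lemma exists_eq_heckeElt (hN : Odd N) (hD : IsUnit (disc A : ZMod N)) (B : heckeGroup A N) :
    ∃ a b : ZMod N, ((B : SL(2, ZMod N)) : Matrix (Fin 2) (Fin 2) (ZMod N)) = heckeElt A a b ∧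
      a ^ 2 - (disc A : ZMod N) * b ^ 2 = 1 := by
  have h2 := two_mul_inv_two hN
  obtain ⟨δ, hδ⟩ := hD.exists_right_inv
  obtain ⟨B, hB⟩ := B
  rw [heckeGroup, Subgroup.mem_centralizer_singleton_iff] at hB
  have hcomm : (B : Matrix (Fin 2) (Fin 2) (ZMod N)) * (red A N : Matrix _ _ _) =
    (red A N : Matrix _ _ _) * (B : Matrix _ _ _) := congrArg Subtype.val hB
  have e : ∀ i j, (red A N : Matrix (Fin 2) (Fin 2) (ZMod N)) i j = ((A i j : ℤ) : ZMod N) :=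
    fun i j => rfl
  have c00 := congrFun (congrFun hcomm 0) 0
  have c01 := congrFun (congrFun hcomm 0) 1
  have c10 := congrFun (congrFun hcomm 1) 0
  simp only [Matrix.mul_apply, Fin.sum_univ_two, e] at c00 c01 c10
  rw [disc_cast] at hδ
  have key : ∃ a b : ZMod N, (B : Matrix (Fin 2) (Fin 2) (ZMod N)) = heckeElt A a b := by
    -- The coefficients are forced by $\mathrm{tr}\,B=2a$ and $\mathrm{tr}(BS)=2Db$. Here
    -- $\delta=D^{-1}$.
    refine ⟨(B 0 0 + B 1 1) * 2⁻¹,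
      (((A 0 0 : ZMod N) - A 1 1) * (B 0 0 - B 1 1) + 2 * A 0 1 * B 1 0 + 2 * A 1 0 * B 0 1)
        * 2⁻¹ * δ, ?_⟩
    rw [heckeElt, sqrtDisc_eq]
    generalize (2 : ZMod N)⁻¹ = h at h2 ⊢
    ext i j
    fin_cases i <;> fin_cases j <;> simp
    · linear_combination (-B 0 0) * h2 - h * (B 0 0 - B 1 1) * hδ
        - h * δ * (2 * A 0 1 * c10 - 2 * A 1 0 * c01)
    · linear_combination (-B 0 1 * 2 * h) * hδ - B 0 1 * h2
        - 2 * h * δ * (((A 0 0 : ZMod N) - A 1 1) * c01 - 2 * A 0 1 * c00)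
    · linear_combination (-B 1 0 * 2 * h) * hδ - B 1 0 * h2
        - 2 * h * δ * (-((A 0 0 : ZMod N) - A 1 1) * c10 + 2 * A 1 0 * c00)
    · linear_combination (-B 1 1) * h2 + h * (B 0 0 - B 1 1) * hδ
        + h * δ * (2 * A 0 1 * c10 - 2 * A 1 0 * c01)
  obtain ⟨a, b, hab⟩ := key
  refine ⟨a, b, hab, ?_⟩
  rw [← det_heckeElt, ← hab]
  exact B.2

lemma heckeGroup_comm (hN : Odd N) (hD : IsUnit (disc A : ZMod N)) (B C : heckeGroup A N) :
    B * C = C * B := by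
  obtain ⟨a, b, hB, -⟩ := exists_eq_heckeElt A hN hD B
  obtain ⟨c, d, hC, -⟩ := exists_eq_heckeElt A hN hD C
  apply Subtype.ext
  apply Subtype.ext
  change (B.1 : Matrix (Fin 2) (Fin 2) (ZMod N)) * C.1 = C.1 * B.1
  rw [hB, hC, heckeElt_mul, heckeElt_mul]
  congr 1 <;> ring

end HeckeAlgebra

/-! ### The Hecke group modulo a prime power -/

section PrimePower

variable {p k : ℕ}

/-- Reduction modulo `p`. -/
def redHom (p : ℕ) {k : ℕ} (hk : 1 ≤ k) : ZMod (p ^ k) →+* ZMod p :=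
  ZMod.castHom (dvd_pow_self p (by omega)) (ZMod p)

lemma redHom_surjective (hk : 1 ≤ k) : Function.Surjective (redHom p hk) :=
  ZMod.castHom_surjective _

variable [Fact p.Prime]

lemma isUnit_iff_redHom_ne_zero (hk : 1 ≤ k) (x : ZMod (p ^ k)) :
    IsUnit x ↔ redHom p hk x ≠ 0 :=
  ⟨fun h => (h.map (redHom p hk)).ne_zero, fun h => isUnit_of_cast_ne_zero x h⟩

lemma exists_eq_mul_of_redHom_eq_zero (hk : 1 ≤ k) {x : ZMod (p ^ k)}
    (hx : redHom p hk x = 0) : ∃ y, x = p * y := by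
  have h1 : ((x.val : ℕ) : ZMod p) = 0 := by
    rw [ZMod.natCast_val]; exact hx
  rw [ZMod.natCast_eq_zero_iff] at h1
  obtain ⟨m, hm⟩ := h1
  refine ⟨m, ?_⟩
  rw [← ZMod.natCast_zmod_val x, hm]
  push_cast; rfl

lemma odd_prime_pow (hp : p ≠ 2) (k : ℕ) : Odd (p ^ k) :=
  ((Fact.out : p.Prime).odd_of_ne_two hp).pow

lemma isUnit_disc {A : SL(2, ℤ)} (hk : 1 ≤ k) (hD : ¬ (p : ℤ) ∣ disc A) :
    IsUnit (disc A : ZMod (p ^ k)) := by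
  rw [isUnit_iff_redHom_ne_zero hk, map_intCast, Ne, ZMod.intCast_zmod_eq_zero_iff_dvd]
  exact hD

lemma disc_ne_zero_mod {A : SL(2, ℤ)} (hD : ¬ (p : ℤ) ∣ disc A) : (disc A : ZMod p) ≠ 0 := by
  rw [Ne, ZMod.intCast_zmod_eq_zero_iff_dvd]
  exact hD

lemma mem_paramSet_iff {A : SL(2, ℤ)} (hk : 1 ≤ k) (x : ZMod (p ^ k)) :
    x ∈ paramSet A p k ↔ IsUnit ((disc A : ZMod (p ^ k)) * x ^ 2 - 1) := by
  rw [isUnit_iff_redHom_ne_zero hk, map_sub, map_mul, map_pow, map_intCast, map_one, sub_ne_zero]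
  rfl

/-- An explicit form of `β(x)`. -/
lemma beta_eq_heckeElt (A : SL(2, ℤ)) (x : paramSet A p k) {u : ZMod (p ^ k)}
    (hu : ((disc A : ZMod (p ^ k)) * (x : ZMod (p ^ k)) ^ 2 - 1) * u = 1) :
    ((beta A p k x : SL(2, ZMod (p ^ k))) : Matrix (Fin 2) (Fin 2) (ZMod (p ^ k))) =
      heckeElt A (1 + 2 * u) (2 * (x : ZMod (p ^ k)) * u) := by
  -- From $(xS-1)(xS+1)=Dx^2-1$ the inverse is $u(1+xS)$.
  have hinv : ((x : ZMod (p ^ k)) • sqrtDisc A (p ^ k) - 1)⁻¹ = heckeElt A u (x * u) := by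
    apply Matrix.inv_eq_right_inv
    have h1 : (x : ZMod (p ^ k)) • sqrtDisc A (p ^ k) - 1 = heckeElt A (-1) x := by
      rw [heckeElt]; module
    rw [h1, heckeElt_mul, ← heckeElt_one_zero]
    congr 1
    · linear_combination hu
    · ring
  change (((x : ZMod (p ^ k)) • sqrtDisc A (p ^ k) + 1) *
      ((x : ZMod (p ^ k)) • sqrtDisc A (p ^ k) - 1)⁻¹) = _
  have h2 : (x : ZMod (p ^ k)) • sqrtDisc A (p ^ k) + 1 = heckeElt A 1 x := by
    rw [heckeElt]; module
  rw [hinv, h2, heckeElt_mul]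
  congr 1
  · linear_combination hu
  · ring

/-- The elements of the Hecke group that are trivial modulo `p`. -/
def heckeKer (A : SL(2, ℤ)) (hk : 1 ≤ k) : Subgroup (heckeGroup A (p ^ k)) :=
  (Matrix.SpecialLinearGroup.map (n := Fin 2) (redHom p hk)).ker.subgroupOf _

lemma mem_heckeKer_iff {A : SL(2, ℤ)} (hk : 1 ≤ k) (B : heckeGroup A (p ^ k)) :
    B ∈ heckeKer A hk ↔ ∀ i j, redHom p hk ((B : SL(2, ZMod (p ^ k))) i j) =
      (1 : Matrix (Fin 2) (Fin 2) (ZMod p)) i j := by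
  rw [heckeKer, Subgroup.mem_subgroupOf, MonoidHom.mem_ker]
  constructor
  · intro h i j
    have := congrArg (fun M : SL(2, ZMod p) => M i j) h
    simpa using this
  · intro h
    ext i j
    simpa using h i j

lemma redHom_heckeElt (A : SL(2, ℤ)) (hk : 1 ≤ k) (a b : ZMod (p ^ k)) (i j : Fin 2) :
    redHom p hk (heckeElt A a b i j) =
      heckeElt A (redHom p hk a) (redHom p hk b) i j := by
  rw [heckeElt, heckeElt, sqrtDisc_eq, sqrtDisc_eq]
  have h2 : redHom p hk 2 = 2 := map_ofNat _ 2
  fin_cases i <;> fin_cases j <;> simp [h2]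

/-- If $a\equiv1$, the norm equation gives $Db^2\equiv0$ modulo $p$, so $b\equiv0$ as well.
Membership in $K$ is therefore visible on $a$ alone. -/
lemma mem_heckeKer_iff_of_eq {A : SL(2, ℤ)} (hp : p ≠ 2) (hk : 1 ≤ k) (hD : ¬ (p : ℤ) ∣ disc A)
    {B : heckeGroup A (p ^ k)} {a b : ZMod (p ^ k)}
    (hB : ((B : SL(2, ZMod (p ^ k))) : Matrix (Fin 2) (Fin 2) (ZMod (p ^ k))) = heckeElt A a b) :
    B ∈ heckeKer A hk ↔ redHom p hk a = 1 := by
  have hdet : a ^ 2 - (disc A : ZMod (p ^ k)) * b ^ 2 = 1 := by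
    rw [← det_heckeElt, ← hB]; exact B.1.2
  have hD' := disc_ne_zero_mod hD
  have hodd : Odd p := (Fact.out : p.Prime).odd_of_ne_two hp
  rw [mem_heckeKer_iff]
  simp only [hB, redHom_heckeElt]
  constructor
  · intro h
    have h1 : heckeElt A (redHom p hk a) (redHom p hk b) = heckeElt A 1 0 := by
      rw [heckeElt_one_zero]; ext i j; exact h i j
    exact (heckeElt_injective A hodd hD'.isUnit h1).1
  · intro h i j
    have h1 := congrArg (redHom p hk) hdet
    rw [map_sub, map_mul, map_pow, map_pow, h, map_intCast, map_one] at h1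
    have h2 : (disc A : ZMod p) * redHom p hk b ^ 2 = 0 := by linear_combination -h1
    have h3 : redHom p hk b = 0 := by
      simpa using (mul_eq_zero.mp h2).resolve_left hD'
    rw [h, h3, heckeElt_one_zero]

lemma redHom_two_ne_zero (hp : p ≠ 2) : (2 : ZMod p) ≠ 0 := by
  have : ((2 : ℕ) : ZMod p) ≠ 0 := by
    rw [Ne, ZMod.natCast_eq_zero_iff, Nat.prime_dvd_prime_iff_eq Fact.out Nat.prime_two]
    exact hp
  exact_mod_cast this

lemma exists_inv_of_mem_paramSet {A : SL(2, ℤ)} (hk : 1 ≤ k) (x : paramSet A p k) :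
    ∃ u, ((disc A : ZMod (p ^ k)) * (x : ZMod (p ^ k)) ^ 2 - 1) * u = 1 :=
  ((mem_paramSet_iff hk _).mp x.2).exists_right_inv

lemma beta_notMem_heckeKer {A : SL(2, ℤ)} (hp : p ≠ 2) (hk : 1 ≤ k) (hD : ¬ (p : ℤ) ∣ disc A)
    (x : paramSet A p k) : beta A p k x ∉ heckeKer A hk := by
  obtain ⟨u, hu⟩ := exists_inv_of_mem_paramSet hk x
  rw [mem_heckeKer_iff_of_eq hp hk hD (beta_eq_heckeElt A x hu), map_add, map_mul, map_one,
    add_eq_left, map_ofNat, mul_eq_zero]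
  rintro (h | h)
  · exact redHom_two_ne_zero hp h
  · have := congrArg (redHom p hk) hu
    rw [map_mul, h, mul_zero, map_one] at this
    exact zero_ne_one this

lemma beta_injective {A : SL(2, ℤ)} (hp : p ≠ 2) (hk : 1 ≤ k) (hD : ¬ (p : ℤ) ∣ disc A) :
    Function.Injective (beta A p k) := by
  intro x y hxy
  obtain ⟨u, hu⟩ := exists_inv_of_mem_paramSet hk x
  obtain ⟨v, hv⟩ := exists_inv_of_mem_paramSet hk y
  have h2 := two_mul_inv_two (odd_prime_pow hp k)
  have h := beta_eq_heckeElt A x hu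
  rw [hxy, beta_eq_heckeElt A y hv] at h
  obtain ⟨h3, h4⟩ := heckeElt_injective A (odd_prime_pow hp k) (isUnit_disc hk hD) h
  have huv : v = u := by linear_combination 2⁻¹ * h3 + (u - v) * h2
  subst huv
  apply Subtype.ext
  have h5 : (x : ZMod (p ^ k)) * v = y * v := by
    linear_combination -2⁻¹ * h4 + (y * v - x * v) * h2
  exact (IsUnit.of_mul_eq_one_right _ hu).mul_right_cancel h5

/-- The Cayley transform is inverted by $x=b/(a-1)$, where $a-1$ is a unit exactly off $K$. The
relation with $b$ is kept for computing parameters of products. -/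
lemma exists_beta_eq {A : SL(2, ℤ)} (hp : p ≠ 2) (hk : 1 ≤ k) (hD : ¬ (p : ℤ) ∣ disc A)
    {B : heckeGroup A (p ^ k)} {a b : ZMod (p ^ k)}
    (hB : ((B : SL(2, ZMod (p ^ k))) : Matrix (Fin 2) (Fin 2) (ZMod (p ^ k))) = heckeElt A a b)
    (hK : B ∉ heckeKer A hk) :
    ∃ x : paramSet A p k, beta A p k x = B ∧ (a - 1) * x = b := by
  have hdet : a ^ 2 - (disc A : ZMod (p ^ k)) * b ^ 2 = 1 := by
    rw [← det_heckeElt, ← hB]; exact B.1.2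
  have h2 := two_mul_inv_two (odd_prime_pow hp k)
  rw [mem_heckeKer_iff_of_eq hp hk hD hB] at hK
  have hunit : IsUnit (a - 1) := by
    rw [isUnit_iff_redHom_ne_zero hk, map_sub, map_one, sub_ne_zero]; exact hK
  obtain ⟨w, hw⟩ := hunit.exists_right_inv
  -- In the explicit form of $\beta$ one has $a=1+2u$, hence $u=(a-1)/2$.
  have hu : ((disc A : ZMod (p ^ k)) * (b * w) ^ 2 - 1) * ((a - 1) * 2⁻¹) = 1 := by
    linear_combination (-w ^ 2 * (a - 1) * 2⁻¹) * hdet +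
      (2⁻¹ * ((a + 1) * (w * (a - 1) + 1))) * hw + h2
  have hx : b * w ∈ paramSet A p k := by
    rw [mem_paramSet_iff hk]
    exact IsUnit.of_mul_eq_one _ hu
  refine ⟨⟨b * w, hx⟩, ?_, by linear_combination b * hw⟩
  apply Subtype.ext
  apply Subtype.ext
  rw [beta_eq_heckeElt A ⟨b * w, hx⟩ hu, hB]
  congr 1
  · linear_combination (a - 1) * h2
  · linear_combination (b * w * (a - 1)) * h2 + b * hw

lemma exists_beta_eq_of_notMem {A : SL(2, ℤ)} (hp : p ≠ 2) (hk : 1 ≤ k)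
    (hD : ¬ (p : ℤ) ∣ disc A) {B : heckeGroup A (p ^ k)} (hK : B ∉ heckeKer A hk) :
    ∃ x : paramSet A p k, beta A p k x = B := by
  obtain ⟨a, b, hB, -⟩ := exists_eq_heckeElt A (odd_prime_pow hp k) (isUnit_disc hk hD) B
  obtain ⟨x, hx, -⟩ := exists_beta_eq hp hk hD hB hK
  exact ⟨x, hx⟩

/-- The scalar coefficient of the product is $1+2Duv(x+y)^2$, with $2Duv$ a unit. -/
lemma beta_mul_mem_heckeKer_iff {A : SL(2, ℤ)} (hp : p ≠ 2) (hk : 1 ≤ k)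
    (hD : ¬ (p : ℤ) ∣ disc A) (x y : paramSet A p k) :
    beta A p k x * beta A p k y ∈ heckeKer A hk ↔ ¬ IsUnit ((x : ZMod (p ^ k)) + y) := by
  obtain ⟨u, hu⟩ := exists_inv_of_mem_paramSet hk x
  obtain ⟨v, hv⟩ := exists_inv_of_mem_paramSet hk y
  have hmul : ((beta A p k x * beta A p k y : heckeGroup A (p ^ k)) :
      SL(2, ZMod (p ^ k))).1 = _ :=
    (congrArg₂ (· * ·) (beta_eq_heckeElt A x hu) (beta_eq_heckeElt A y hv)).trans
      (heckeElt_mul A _ _ _ _)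
  rw [mem_heckeKer_iff_of_eq hp hk hD hmul, isUnit_iff_redHom_ne_zero hk, not_not]
  have key : (1 + 2 * u) * (1 + 2 * v) + (disc A : ZMod (p ^ k)) * (2 * x * u * (2 * y * v)) =
      1 + 2 * (disc A : ZMod (p ^ k)) * (u * v) * ((x : ZMod (p ^ k)) + y) ^ 2 := by
    linear_combination (-2 * v) * hu + (-2 * u) * hv
  have hu0 : redHom p hk u ≠ 0 := (isUnit_iff_redHom_ne_zero hk u).mp
    (IsUnit.of_mul_eq_one_right _ hu)
  have hv0 : redHom p hk v ≠ 0 := (isUnit_iff_redHom_ne_zero hk v).mp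
    (IsUnit.of_mul_eq_one_right _ hv)
  have h2 : redHom p hk 2 = 2 := map_ofNat _ 2
  rw [key]
  simp [h2, redHom_two_ne_zero hp, disc_ne_zero_mod hD, hu0, hv0]

end PrimePower

/-! ### Traces of the propagator -/

section Traces

variable {N : ℕ} [NeZero N]

lemma vecMul_vecMul_inv {N : ℕ} (B : SL(2, ZMod N)) (n : Fin 2 → ZMod N) :
    (n ᵥ* (B : Matrix (Fin 2) (Fin 2) (ZMod N))) ᵥ*
      ((B⁻¹ : SL(2, ZMod N)) : Matrix (Fin 2) (Fin 2) (ZMod N)) = n := by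
  simpa using vecMul_inv_vecMul B⁻¹ n

lemma IsIntertwiner.heis_vecMul {B : SL(2, ZMod N)} {V : Matrix (ZMod N) (ZMod N) ℂ}
    (h : IsIntertwiner B⁻¹ V) (n : Fin 2 → ZMod N) :
    heis (n ᵥ* (B : Matrix (Fin 2) (Fin 2) (ZMod N))) * V = V * heis n := by
  rw [h, vecMul_vecMul_inv]

/-- If $n=m(B-1)$, then $T(n)$ is a phase times $T(-m)T(mB)$. Moving $T(mB)$ through $V$ turns it
into $T(m)$, which cancels against $T(-m)$ under the trace. -/
lemma IsIntertwiner.trace_conj (hN : Odd N) {B : SL(2, ZMod N)}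
    {V : Matrix (ZMod N) (ZMod N) ℂ} (h : IsIntertwiner B⁻¹ V) (n m : Fin 2 → ZMod N)
    (hm : m ᵥ* ((B : Matrix (Fin 2) (Fin 2) (ZMod N)) - 1) = n) :
    (heis n * V).trace = ZMod.stdAddChar (sympMod m n * 2⁻¹) * V.trace := by
  have hmB : m ᵥ* (B : Matrix (Fin 2) (Fin 2) (ZMod N)) = n + m := by
    rw [← hm, Matrix.vecMul_sub, Matrix.vecMul_one, sub_add_cancel]
  have h1 : heis (-m) * heis (n + m) =
      (ZMod.stdAddChar (-(sympMod m n * 2⁻¹)) : ℂ) • heis n := by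
    rw [heis_mul hN, neg_add_cancel_comm_assoc]
    congr 3
    simp only [sympMod, Pi.neg_apply, Pi.add_apply]; ring
  have h2 : (heis (-m) * heis (n + m) * V).trace = V.trace := by
    rw [← hmB, mul_assoc, h.heis_vecMul, Matrix.trace_mul_comm, mul_assoc, heis_mul_neg hN,
      mul_one]
  rw [h1, Matrix.smul_mul, Matrix.trace_smul, smul_eq_mul] at h2
  rw [← h2, ← mul_assoc, ← AddChar.map_add_eq_mul]
  simp

/-- For fixed $m$, $T(m)$ commutes with $V$, while conjugation by it multiplies $T(n)$ by
$e_N(\omega(n,m))\ne1$. The trace equals a nontrivial multiple of itself. -/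
lemma IsIntertwiner.trace_eq_zero (hN : Odd N) {B : SL(2, ZMod N)}
    {V : Matrix (ZMod N) (ZMod N) ℂ} (h : IsIntertwiner B⁻¹ V) (n m : Fin 2 → ZMod N)
    (hm : m ᵥ* (B : Matrix (Fin 2) (Fin 2) (ZMod N)) = m) (hnm : sympMod n m ≠ 0) :
    (heis n * V).trace = 0 := by
  have h2i := two_mul_inv_two hN
  have h1 : heis (-m) * heis n * heis m =
      (ZMod.stdAddChar (sympMod n m) : ℂ) • heis n := by
    rw [heis_mul hN, Matrix.smul_mul, heis_mul hN, smul_smul, ← AddChar.map_add_eq_mul,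
      neg_add_cancel_comm]
    congr 2
    simp only [sympMod, Pi.neg_apply, Pi.add_apply]
    linear_combination (n 0 * m 1 - n 1 * m 0) * h2i
  have h2 : (heis (-m) * heis n * heis m * V).trace = (heis n * V).trace := by
    have h3 := h.heis_vecMul m
    rw [hm] at h3
    rw [mul_assoc, h3, mul_assoc (heis (-m)), Matrix.trace_mul_comm, ← mul_assoc, mul_assoc,
      heis_mul_neg hN, mul_one]
  rw [h1, Matrix.smul_mul, Matrix.trace_smul, smul_eq_mul] at h2
  have h4 : ((ZMod.stdAddChar (sympMod n m) : ℂ) - 1) * (heis n * V).trace = 0 := by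
    linear_combination h2
  refine (mul_eq_zero.mp h4).resolve_left fun h5 => hnm ?_
  apply ZMod.injective_stdAddChar
  rw [AddChar.map_zero_eq_one]
  exact sub_eq_zero.mp h5

/-- `|tr U(B)|²` is the number of fixed points of `B`. -/
lemma trace_mul_trace_inv (hN : Odd N) (M : SL(2, ZMod N) →* Matrix (ZMod N) (ZMod N) ℂ)
    (hM : ∀ B, IsIntertwiner B (M B)) (B : SL(2, ZMod N)) :
    (M B).trace * (M B⁻¹).trace =
      (Fintype.card {n : Fin 2 → ZMod N //
        n ᵥ* (B : Matrix (Fin 2) (Fin 2) (ZMod N)) = n} : ℂ) := by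
  have hN0 : (N : ℂ) ≠ 0 := NeZero.ne _
  have h := congrArg (fun X => (X * M B).trace) (sum_heis_conj hN (M B⁻¹))
  simp only [Finset.sum_mul, Matrix.trace_sum, Matrix.smul_mul, one_mul, Matrix.trace_smul,
    smul_eq_mul] at h
  -- Moving $T(n)$ past $M(B)$ leaves $T(-n)T(nB)$, whose trace is nonzero only when $nB=n$.
  have h1 : ∀ n : Fin 2 → ZMod N, (heis (-n) * M B⁻¹ * heis n * M B).trace =
      if n ᵥ* (B : Matrix (Fin 2) (Fin 2) (ZMod N)) = n then (N : ℂ) else 0 := fun n => by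
    rw [mul_assoc, hM B n, mul_assoc, ← mul_assoc (M B⁻¹), ← map_mul, inv_mul_cancel, map_one,
      one_mul, heis_mul hN, Matrix.trace_smul, trace_heis, smul_eq_mul]
    simp only [neg_add_eq_zero, mul_ite, mul_zero]
    by_cases hn : n ᵥ* (B : Matrix (Fin 2) (Fin 2) (ZMod N)) = n
    · rw [if_pos hn, if_pos hn.symm, hn, sympMod_neg_left, sympMod_self]
      simp
    · rw [if_neg hn, if_neg (Ne.symm hn)]
  simp only [h1, Finset.sum_ite, Finset.sum_const,
    nsmul_eq_mul] at h
  rw [Fintype.card_subtype]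
  apply mul_left_cancel₀ hN0
  linear_combination -h

lemma trace_ne_zero (hN : Odd N) (M : SL(2, ZMod N) →* Matrix (ZMod N) (ZMod N) ℂ)
    (hM : ∀ B, IsIntertwiner B (M B)) (B : SL(2, ZMod N)) : (M B).trace ≠ 0 := by
  intro h
  have h1 := trace_mul_trace_inv hN M hM B
  rw [h, zero_mul, eq_comm, Nat.cast_eq_zero, Fintype.card_eq_zero_iff] at h1
  exact h1.elim ⟨0, Matrix.zero_vecMul _⟩

end Traces

/-! ### The quadratic Gauss sums of the form `Q` -/

section Gauss

variable (A : SL(2, ℤ)) {N : ℕ}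

/-- The quadratic form `Q` modulo `N`. -/
def quadMod (n : Fin 2 → ZMod N) : ZMod N :=
  sympMod (n ᵥ* (red A N : Matrix (Fin 2) (Fin 2) (ZMod N))) n

lemma quadMod_intCast (n : Fin 2 → ℤ) :
    quadMod A (fun i => (n i : ZMod N)) = (quadForm A n : ZMod N) := by
  have e : ∀ i j, (red A N : Matrix (Fin 2) (Fin 2) (ZMod N)) i j = ((A i j : ℤ) : ZMod N) :=
    fun i j => rfl
  simp [quadMod, quadForm, sympMod, symp, Matrix.vecMul, dotProduct, Fin.sum_univ_two, e]

lemma sympMod_vecMul_sqrtDisc_self (n : Fin 2 → ZMod N) :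
    sympMod (n ᵥ* sqrtDisc A N) n = 2 * quadMod A n := by
  have e : ∀ i j, (red A N : Matrix (Fin 2) (Fin 2) (ZMod N)) i j = ((A i j : ℤ) : ZMod N) :=
    fun i j => rfl
  rw [sqrtDisc_eq]
  simp [quadMod, sympMod, Matrix.vecMul, dotProduct, Fin.sum_univ_two, e]
  ring

lemma quadMod_neg (n : Fin 2 → ZMod N) : quadMod A (-n) = quadMod A n := by
  simp only [quadMod, Matrix.neg_vecMul, sympMod_neg_left, sympMod_neg_right, neg_neg]

/-- The polar form of $Q$ is $\omega(nS,m)$, nondegenerate once $S^2=D$ is a unit. -/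
lemma quadMod_add (n m : Fin 2 → ZMod N) :
    quadMod A (n + m) = quadMod A n + quadMod A m + sympMod (n ᵥ* sqrtDisc A N) m := by
  have e : ∀ i j, (red A N : Matrix (Fin 2) (Fin 2) (ZMod N)) i j = ((A i j : ℤ) : ZMod N) :=
    fun i j => rfl
  rw [sqrtDisc_eq]
  simp [quadMod, sympMod, Matrix.vecMul, dotProduct, Fin.sum_univ_two, e]
  ring

/-- Elements $a+bS$ commute with $A$, so they scale $Q$ by their determinant, which is the norm. -/
lemma quadMod_vecMul_heckeElt (a b : ZMod N) (n : Fin 2 → ZMod N) :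
    quadMod A (n ᵥ* heckeElt A a b) =
      (a ^ 2 - (disc A : ZMod N) * b ^ 2) * quadMod A n := by
  rw [quadMod, Matrix.vecMul_vecMul, ← (commute_red_heckeElt A a b).eq, ← Matrix.vecMul_vecMul,
    ← det_heckeElt, quadMod]
  simp only [sympMod, Matrix.vecMul, dotProduct, Fin.sum_univ_two, Matrix.det_fin_two]
  ring

variable [NeZero N]

/-- The Gauss sum `∑ₙ e_N(z Q(n) / 2)`. -/
noncomputable def gaussQ (z : ZMod N) : ℂ :=
  ∑ n : Fin 2 → ZMod N, ZMod.stdAddChar (z * quadMod A n * 2⁻¹)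

lemma gaussQ_mul_norm (z a b : ZMod N) (hab : IsUnit (a ^ 2 - (disc A : ZMod N) * b ^ 2)) :
    gaussQ A (z * (a ^ 2 - (disc A : ZMod N) * b ^ 2)) = gaussQ A z := by
  have hbij : Function.Bijective (fun n : Fin 2 → ZMod N => n ᵥ* heckeElt A a b) := by
    rw [Finite.injective_iff_bijective.symm]
    rw [← det_heckeElt, ← Matrix.isUnit_iff_isUnit_det] at hab
    obtain ⟨g, hg⟩ := hab
    intro n m hnm
    have := congrArg (fun v => v ᵥ* (g⁻¹ : (Matrix (Fin 2) (Fin 2) (ZMod N))ˣ).1) hnm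
    simpa [Matrix.vecMul_vecMul, ← hg] using this
  rw [gaussQ, gaussQ]
  rw [← hbij.sum_comp (fun n => (ZMod.stdAddChar (z * quadMod A n * 2⁻¹) : ℂ))]
  refine Finset.sum_congr rfl fun n _ => ?_
  rw [quadMod_vecMul_heckeElt, mul_assoc z]

lemma sum_stdAddChar_sympMod (v : Fin 2 → ZMod N) (c : ZMod N) (hc : IsUnit c) :
    ∑ m : Fin 2 → ZMod N, (ZMod.stdAddChar (sympMod v m * c) : ℂ) =
      if v = 0 then (N : ℂ) ^ 2 else 0 := by
  rw [sum_fin_two_fun]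
  have h1 : ∀ a b : ZMod N, (ZMod.stdAddChar (sympMod v ![a, b] * c) : ℂ) =
      ZMod.stdAddChar (a * (-v 1 * c)) * ZMod.stdAddChar (b * (v 0 * c)) := fun a b => by
    rw [← AddChar.map_add_eq_mul]
    congr 1
    simp only [sympMod, Matrix.cons_val_zero, Matrix.cons_val_one]; ring
  simp only [h1, ← Finset.mul_sum, ← Finset.sum_mul, sum_stdAddChar_mul]
  have hz : v = 0 ↔ v 1 = 0 ∧ v 0 = 0 := by
    constructor
    · rintro rfl; exact ⟨rfl, rfl⟩
    · rintro ⟨h1, h0⟩; ext i; fin_cases i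
      · exact h0
      · exact h1
  simp only [hc.mul_left_eq_zero, neg_eq_zero]
  by_cases h1 : v 1 = 0 <;> by_cases h0 : v 0 = 0 <;> simp [hz, h0, h1, sq]

/-- Substitute $n=l+m$ and polarize. The sum over $m$ forces $lS=0$, hence $l=0$. -/
lemma gaussQ_one_mul_neg_one (hN : Odd N) (hD : IsUnit (disc A : ZMod N)) :
    gaussQ A (1 : ZMod N) * gaussQ A (-1 : ZMod N) = (N : ℂ) ^ 2 := by
  have h2 := two_mul_inv_two hN
  have hhalf : IsUnit (2⁻¹ : ZMod N) := IsUnit.of_mul_eq_one_right _ h2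
  obtain ⟨δ, hδ⟩ := hD.exists_right_inv
  have hS : ∀ l : Fin 2 → ZMod N, l ᵥ* sqrtDisc A N = 0 ↔ l = 0 := fun l => by
    constructor
    · intro h
      have := congrArg (fun v => δ • (v ᵥ* sqrtDisc A N)) h
      simpa [Matrix.vecMul_vecMul, sqrtDisc_mul_self, Matrix.vecMul_smul, smul_smul,
        mul_comm δ, hδ] using this
    · rintro rfl; simp
  rw [gaussQ, gaussQ, Finset.sum_mul_sum, Finset.sum_comm]
  have h3 : ∀ m : Fin 2 → ZMod N, ∑ n : Fin 2 → ZMod N,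
      (ZMod.stdAddChar (1 * quadMod A n * 2⁻¹) : ℂ) *
        ZMod.stdAddChar (-1 * quadMod A m * 2⁻¹) =
      ∑ l : Fin 2 → ZMod N, (ZMod.stdAddChar (quadMod A l * 2⁻¹) : ℂ) *
        ZMod.stdAddChar (sympMod (l ᵥ* sqrtDisc A N) m * 2⁻¹) := fun m => by
    refine Fintype.sum_equiv (Equiv.subRight m) _ _ fun n => ?_
    obtain ⟨l, rfl⟩ : ∃ l, n = l + m := ⟨n - m, by simp⟩
    rw [Equiv.subRight_apply, add_sub_cancel_right, ← AddChar.map_add_eq_mul,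
      ← AddChar.map_add_eq_mul, quadMod_add]
    congr 1
    ring
  simp only [h3]
  rw [Finset.sum_comm]
  simp only [← Finset.mul_sum, sum_stdAddChar_sympMod _ _ hhalf, hS, mul_ite, mul_zero,
    Finset.sum_ite_eq', Finset.mem_univ, if_true]
  simp [quadMod, sympMod]

end Gauss

/-! ### Norms $a^2-Db^2$ represent every unit. -/

section NormSurjective

variable {p k : ℕ} [Fact p.Prime]

/-- If $u\equiv1$ modulo $p$, then $u^{p^{k-1}}=1$. The exponent is odd, $p^{k-1}=2j+1$, so
$u=(u^{j+1})^2$. -/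
lemma exists_sq_of_redHom_eq_one (hp : p ≠ 2) (hk : 1 ≤ k) {u : ZMod (p ^ k)}
    (hu : redHom p hk u = 1) : ∃ r, r ^ 2 = u := by
  obtain ⟨y, hy⟩ := exists_eq_mul_of_redHom_eq_zero hk (x := u - 1) (by simp [hu])
  obtain ⟨w, hw⟩ := dvd_sub_pow_of_dvd_sub (p := p) ⟨y, hy⟩ (k - 1)
  have h0 : (p : ZMod (p ^ k)) ^ (k - 1 + 1) = 0 := by
    rw [Nat.sub_add_cancel hk]
    exact_mod_cast ZMod.natCast_self (p ^ k)
  rw [h0, zero_mul, one_pow, sub_eq_zero] at hw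
  obtain ⟨j, hj⟩ := odd_prime_pow hp (k - 1)
  refine ⟨u ^ (j + 1), ?_⟩
  rw [← pow_mul, show (j + 1) * 2 = p ^ (k - 1) + 1 by omega, pow_succ, hw, one_mul]

lemma exists_sq_of_redHom_eq_sq (hp : p ≠ 2) (hk : 1 ≤ k) {u : ZMod (p ^ k)} (hu : IsUnit u)
    {r : ZMod p} (hr : r ^ 2 = redHom p hk u) : ∃ s, s ^ 2 = u := by
  obtain ⟨t, rfl⟩ := redHom_surjective hk r
  have ht : IsUnit t := by
    rw [isUnit_iff_redHom_ne_zero hk] at hu ⊢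
    rintro h0
    rw [h0] at hr
    exact hu (by rw [← hr]; ring)
  obtain ⟨w, hw⟩ := ht.exists_right_inv
  obtain ⟨s, hs⟩ := exists_sq_of_redHom_eq_one hp hk (u := u * w ^ 2) (by
    rw [map_mul, ← hr, ← map_pow, ← map_mul, ← mul_pow, hw, one_pow, map_one])
  exact ⟨s * t, by rw [mul_pow, hs]; linear_combination u * (w * t + 1) * hw⟩

/-- Modulo $p$ a solution exists by counting values of quadratics. To lift it, fix one coordinate
and extract a square root for the other, which must be nonzero modulo $p$; hence the cases $a=0$ and
$a\ne0$. -/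
lemma exists_norm_eq (A : SL(2, ℤ)) (hp : p ≠ 2) (hk : 1 ≤ k) (hD : ¬ (p : ℤ) ∣ disc A)
    {u : ZMod (p ^ k)} (hu : IsUnit u) : ∃ a b, a ^ 2 - (disc A : ZMod (p ^ k)) * b ^ 2 = u := by
  have hD' := disc_ne_zero_mod hD
  have hu' := (isUnit_iff_redHom_ne_zero hk u).mp hu
  obtain ⟨a, b, hab⟩ : ∃ a b : ZMod p, a ^ 2 - (disc A : ZMod p) * b ^ 2 = redHom p hk u := by
    open Polynomial in
    obtain ⟨a, b, h⟩ := FiniteField.exists_root_sum_quadratic (R := ZMod p)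
      (f := X ^ 2 - C (redHom p hk u)) (g := C (-(disc A : ZMod p)) * X ^ 2)
      (degree_X_pow_sub_C (by decide) _) (degree_C_mul_X_pow 2 (neg_ne_zero.mpr hD'))
      (by rw [ZMod.card]; exact Nat.odd_iff.mp ((Fact.out : p.Prime).odd_of_ne_two hp))
    simp only [Polynomial.eval_sub, Polynomial.eval_pow, Polynomial.eval_X, Polynomial.eval_C,
      Polynomial.eval_mul] at h
    exact ⟨a, b, by linear_combination h⟩
  obtain ⟨δ, hδ⟩ := (isUnit_disc (k := k) hk hD).exists_right_inv
  by_cases ha : a = 0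
  · subst ha
    obtain ⟨s, hs⟩ := exists_sq_of_redHom_eq_sq hp hk (u := -u * δ) (r := b)
      (hu.neg.mul (IsUnit.of_mul_eq_one_right _ hδ)) (by
        have h1 := congrArg (redHom p hk) hδ
        rw [map_mul, map_intCast, map_one] at h1
        rw [map_mul, map_neg, ← hab]
        linear_combination (-b ^ 2) * h1)
    exact ⟨0, s, by rw [hs]; linear_combination u * hδ⟩
  · obtain ⟨t, rfl⟩ := redHom_surjective hk b
    have h1 : redHom p hk (u + (disc A : ZMod (p ^ k)) * t ^ 2) = a ^ 2 := by
      rw [map_add, map_mul, map_pow, map_intCast, ← hab]; ring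
    obtain ⟨s, hs⟩ := exists_sq_of_redHom_eq_sq hp hk
      (u := u + (disc A : ZMod (p ^ k)) * t ^ 2) (r := a)
      ((isUnit_iff_redHom_ne_zero hk _).mpr (by rw [h1]; exact pow_ne_zero 2 ha)) h1.symm
    exact ⟨s, t, by rw [hs]; ring⟩

end NormSurjective

/-! ### The trace on the Hecke group is a character up to sign -/

section HeckeTrace

variable {p k : ℕ} [Fact p.Prime] (A : SL(2, ℤ))

lemma gaussQ_mul_unit (hp : p ≠ 2) (hk : 1 ≤ k) (hD : ¬ (p : ℤ) ∣ disc A)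
    (z : ZMod (p ^ k)) {u : ZMod (p ^ k)} (hu : IsUnit u) :
    gaussQ A (z * u) = gaussQ A z := by
  obtain ⟨a, b, rfl⟩ := exists_norm_eq A hp hk hD hu
  exact gaussQ_mul_norm A z a b hu

/-- All units give the same Gauss sum, in particular $1$ and $-1$, so its square is $p^{2k}$. -/
lemma exists_sign_gaussQ (hp : p ≠ 2) (hk : 1 ≤ k) (hD : ¬ (p : ℤ) ∣ disc A) :
    ∃ ε : ℤˣ, ∀ u : ZMod (p ^ k), IsUnit u →
      gaussQ A u = ((ε : ℤ) : ℂ) * ((p ^ k : ℕ) : ℂ) := by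
  have h := gaussQ_one_mul_neg_one A (odd_prime_pow hp k) (isUnit_disc hk hD)
  have h1 : ∀ u : ZMod (p ^ k), IsUnit u → gaussQ A u = gaussQ A (1 : ZMod (p ^ k)) :=
    fun u hu => by rw [← gaussQ_mul_unit A hp hk hD 1 hu, one_mul]
  rw [h1 (-1) isUnit_one.neg, ← sq, sq_eq_sq_iff_eq_or_eq_neg] at h
  rcases h with h | h
  · exact ⟨1, fun u hu => by rw [h1 u hu, h]; simp⟩
  · exact ⟨-1, fun u hu => by rw [h1 u hu, h]; simp⟩

variable (M : SL(2, ZMod (p ^ k)) →* Matrix (ZMod (p ^ k)) (ZMod (p ^ k)) ℂ)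

variable {A} in
-- Since $(\beta(x)-1)^{-1}=(xS-1)/2$, the vector $m=n(xS-1)/2$ has $\omega(m,n)=xQ(n)$. The Cayley
-- parameter is what makes the phase linear in $x$.
lemma trace_heis_mul_beta (hp : p ≠ 2) (hk : 1 ≤ k) (hM : ∀ B, IsIntertwiner B (M B))
    (x : paramSet A p k) (n : Fin 2 → ZMod (p ^ k)) :
    (heis n * M (beta A p k x : SL(2, ZMod (p ^ k)))⁻¹).trace =
      ZMod.stdAddChar ((x : ZMod (p ^ k)) * quadMod A n * 2⁻¹) *
        (M (beta A p k x : SL(2, ZMod (p ^ k)))⁻¹).trace := by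
  have hodd := odd_prime_pow hp k
  have h2 := two_mul_inv_two hodd
  obtain ⟨u, hu⟩ := exists_inv_of_mem_paramSet hk x
  have hinv : heckeElt A (-2⁻¹) ((x : ZMod (p ^ k)) * 2⁻¹) *
      (((beta A p k x : SL(2, ZMod (p ^ k))) : Matrix (Fin 2) (Fin 2) (ZMod (p ^ k))) - 1) = 1 := by
    rw [beta_eq_heckeElt A x hu, ← heckeElt_one_zero A]
    have : heckeElt A (1 + 2 * u) (2 * (x : ZMod (p ^ k)) * u) - heckeElt A 1 0 =
        heckeElt A (2 * u) (2 * (x : ZMod (p ^ k)) * u) := by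
      simp only [heckeElt]; module
    rw [this, heckeElt_mul]
    congr 1
    · linear_combination (2 * 2⁻¹) * hu + h2
    · ring
  rw [(hM _).trace_conj hodd n (n ᵥ* heckeElt A (-2⁻¹) ((x : ZMod (p ^ k)) * 2⁻¹))
    (by rw [Matrix.vecMul_vecMul, hinv, Matrix.vecMul_one])]
  congr 3
  have hS := sympMod_vecMul_sqrtDisc_self A n
  rw [heckeElt, Matrix.vecMul_add, Matrix.vecMul_smul, Matrix.vecMul_smul, Matrix.vecMul_one]
  simp only [sympMod, Pi.add_apply, Pi.smul_apply, smul_eq_mul] at hS ⊢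
  linear_combination ((x : ZMod (p ^ k)) * 2⁻¹) * hS + (x : ZMod (p ^ k)) * quadMod A n * h2

variable {A} in
-- Insert the previous formula into Plancherel's identity. The phases in $x$ and $y$ combine into a
-- Gauss sum.
lemma trace_beta_mul_beta (hp : p ≠ 2) (hk : 1 ≤ k) (hD : ¬ (p : ℤ) ∣ disc A)
    (hM : ∀ B, IsIntertwiner B (M B)) (x y : paramSet A p k) :
    ((p ^ k : ℕ) : ℂ) * (M ((beta A p k x * beta A p k y : heckeGroup A (p ^ k)) :
      SL(2, ZMod (p ^ k)))⁻¹).trace =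
      (M (beta A p k x : SL(2, ZMod (p ^ k)))⁻¹).trace *
      (M (beta A p k y : SL(2, ZMod (p ^ k)))⁻¹).trace *
        gaussQ A ((x : ZMod (p ^ k)) + (y : ZMod (p ^ k))) := by
  have hodd := odd_prime_pow hp k
  have h1 := sum_trace_heis_mul hodd (M (beta A p k x : SL(2, ZMod (p ^ k)))⁻¹)
    (M (beta A p k y : SL(2, ZMod (p ^ k)))⁻¹)
  rw [← map_mul, ← _root_.mul_inv_rev, ← Subgroup.coe_mul,
    heckeGroup_comm A hodd (isUnit_disc hk hD)] at h1
  rw [← h1, gaussQ, Finset.mul_sum]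
  refine Finset.sum_congr rfl fun n _ => ?_
  rw [trace_heis_mul_beta M hp hk hM, trace_heis_mul_beta M hp hk hM, quadMod_neg, add_mul, add_mul,
    AddChar.map_add_eq_mul]
  ring

lemma zero_mem_paramSet (hk : 1 ≤ k) : (0 : ZMod (p ^ k)) ∈ paramSet A p k := by
  rw [mem_paramSet_iff hk]
  simp

/-- The element `-1` of the Hecke group, as a value of `β`. -/
lemma beta_zero (hk : 1 ≤ k) : ((beta A p k ⟨0, zero_mem_paramSet A hk⟩ : SL(2, ZMod (p ^ k))) :
    Matrix (Fin 2) (Fin 2) (ZMod (p ^ k))) = heckeElt A (-1) 0 := by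
  rw [beta_eq_heckeElt A ⟨0, zero_mem_paramSet A hk⟩ (u := -1) (by simp)]
  congr 1
  · ring
  · simp

lemma beta_zero_mul_self (hk : 1 ≤ k) :
    beta A p k ⟨0, zero_mem_paramSet A hk⟩ * beta A p k ⟨0, zero_mem_paramSet A hk⟩ = 1 := by
  apply Subtype.ext
  apply Subtype.ext
  refine (congrArg₂ (· * ·) (beta_zero A hk) (beta_zero A hk)).trans
    ((heckeElt_mul A _ _ _ _).trans ?_)
  change _ = (1 : Matrix (Fin 2) (Fin 2) (ZMod (p ^ k)))
  rw [← heckeElt_one_zero A]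
  congr 1 <;> ring

variable {A} in
-- A product in $K$ has no Cayley parameter, but its negative does. That parameter is a unit times
-- $x+y$, so both have the same Gauss sum even when it is degenerate.
lemma exists_param_of_mul_mem_heckeKer (hp : p ≠ 2) (hk : 1 ≤ k) (hD : ¬ (p : ℤ) ∣ disc A)
    (x y : paramSet A p k) (hxy : beta A p k x * beta A p k y ∈ heckeKer A hk) :
    ∃ z : paramSet A p k, beta A p k z =
        beta A p k ⟨0, zero_mem_paramSet A hk⟩ * (beta A p k x * beta A p k y) ∧
      ∃ w : ZMod (p ^ k), IsUnit w ∧ (z : ZMod (p ^ k)) = ((x : ZMod (p ^ k)) + y) * w := by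
  obtain ⟨u, hu⟩ := exists_inv_of_mem_paramSet hk x
  obtain ⟨v, hv⟩ := exists_inv_of_mem_paramSet hk y
  set c := beta A p k ⟨0, zero_mem_paramSet A hk⟩ with hc
  have hcK : c * (beta A p k x * beta A p k y) ∉ heckeKer A hk := fun h =>
    beta_notMem_heckeKer hp hk hD _ (((heckeKer A hk).mul_mem_cancel_right hxy).mp h)
  have hel : ((c * (beta A p k x * beta A p k y) : heckeGroup A (p ^ k)) :
      SL(2, ZMod (p ^ k))).1 = _ :=
    (congrArg₂ (· * ·) (beta_zero A hk) ((congrArg₂ (· * ·) (beta_eq_heckeElt A x hu)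
      (beta_eq_heckeElt A y hv)).trans (heckeElt_mul A _ _ _ _))).trans (heckeElt_mul A _ _ _ _)
  obtain ⟨z, hz, hzb⟩ := exists_beta_eq hp hk hD hel hcK
  refine ⟨z, hz, ?_⟩
  rw [mem_heckeKer_iff_of_eq hp hk hD hel, ← ne_eq, ← sub_ne_zero,
    ← map_one (redHom p hk), ← map_sub, ← isUnit_iff_redHom_ne_zero] at hcK
  obtain ⟨w, hw⟩ := hcK.exists_right_inv
  have hz0 : redHom p hk ((x : ZMod (p ^ k)) + y) = 0 := by
    by_contra h
    exact (beta_mul_mem_heckeKer_iff hp hk hD x y).mp hxy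
      ((isUnit_iff_redHom_ne_zero hk _).mpr h)
  -- Here $y\equiv-x$ modulo $p$, so this element is congruent to $1-Dx^2$, a unit.
  have hunit : IsUnit (1 + (disc A : ZMod (p ^ k)) * x * y) := by
    have h1 := (isUnit_iff_redHom_ne_zero hk _).mp ((mem_paramSet_iff hk _).mp x.2)
    rw [isUnit_iff_redHom_ne_zero hk]
    rw [map_add] at hz0
    intro h0
    apply h1
    simp only [map_sub, map_add, map_mul, map_pow, map_one] at h0 ⊢
    linear_combination (redHom p hk (disc A : ZMod (p ^ k)) * redHom p hk x) * hz0 - h0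
  have htwo : IsUnit (-2 : ZMod (p ^ k)) :=
    (IsUnit.of_mul_eq_one _ (two_mul_inv_two (odd_prime_pow hp k))).neg
  -- The $S$-coefficient of $-\beta(x)\beta(y)$ is $-2uv(1+Dxy)(x+y)$. Dividing by the scalar
  -- coefficient minus $1$ gives $z$.
  refine ⟨-2 * (u * v) * (1 + (disc A : ZMod (p ^ k)) * x * y) * w,
    ((htwo.mul ((IsUnit.of_mul_eq_one_right _ hu).mul (IsUnit.of_mul_eq_one_right _ hv))).mul
      hunit).mul (IsUnit.of_mul_eq_one_right _ hw), ?_⟩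
  linear_combination w * hzb - (z : ZMod (p ^ k)) * hw + (2 * y * v * w) * hu + (2 * x * u * w) * hv

variable {A} in
/-- On the elements `β(x)` the trace of the propagator is a character up to a sign. -/
theorem exists_char_eq_trace_beta (hp : p ≠ 2) (hk : 1 ≤ k) (hD : ¬ (p : ℤ) ∣ disc A)
    (hM : ∀ B, IsIntertwiner B (M B)) :
    ∃ (ε : ℤˣ) (χ₀ : HeckeChar A (p ^ k)), ∀ x : paramSet A p k,
      (M (beta A p k x : SL(2, ZMod (p ^ k)))⁻¹).trace =
        ((ε : ℤ) : ℂ) * (χ₀ (beta A p k x) : ℂ) := by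
  have hodd := odd_prime_pow hp k
  obtain ⟨ε, hε⟩ := exists_sign_gaussQ A hp hk hD
  have hpk : ((p ^ k : ℕ) : ℂ) ≠ 0 := NeZero.ne _
  have hεε : ((ε : ℤ) : ℂ) * ((ε : ℤ) : ℂ) = 1 := by
    rw [← Int.cast_mul, ← Units.val_mul, Int.units_mul_self]; simp
  have hε0 : ((ε : ℤ) : ℂ) ≠ 0 := left_ne_zero_of_mul_eq_one hεε
  have ht0 : ∀ B : heckeGroup A (p ^ k), (M (B : SL(2, ZMod (p ^ k)))⁻¹).trace ≠ 0 := fun B =>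
    trace_ne_zero hodd M hM _
  set f : heckeGroup A (p ^ k) → ℂˣ := fun B =>
    Units.mk0 (((ε : ℤ) : ℂ) * (M (B : SL(2, ZMod (p ^ k)))⁻¹).trace)
      (mul_ne_zero hε0 (ht0 B)) with hf
  have hfv : ∀ B, (f B : ℂ) = ((ε : ℤ) : ℂ) * (M (B : SL(2, ZMod (p ^ k)))⁻¹).trace :=
    fun B => rfl
  set c := beta A p k ⟨0, zero_mem_paramSet A hk⟩ with hc
  have hcinv : (c : SL(2, ZMod (p ^ k)))⁻¹ = c :=
    inv_eq_of_mul_eq_one_left (congrArg Subtype.val (beta_zero_mul_self A hk))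
  obtain ⟨χ, hχ⟩ := exists_monoidHom_eq_off_subgroup
    (heckeGroup_comm A hodd (isUnit_disc hk hD)) (heckeKer A hk) c
    (beta_notMem_heckeKer hp hk hD _) (beta_zero_mul_self A hk) f
    (by
      apply Units.ext
      -- The element $c=-1$ is its own inverse and fixes only $0$, so its trace has square $1$.
      have h1 := trace_mul_trace_inv hodd M hM (c : SL(2, ZMod (p ^ k)))
      have h2 : Fintype.card {n : Fin 2 → ZMod (p ^ k) // n ᵥ* ((c : SL(2, ZMod (p ^ k))) :
          Matrix (Fin 2) (Fin 2) (ZMod (p ^ k))) = n} = 1 := by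
        rw [Fintype.card_eq_one_iff]
        refine ⟨⟨0, Matrix.zero_vecMul _⟩, ?_⟩
        rintro ⟨n, h3⟩
        apply Subtype.ext
        rw [beta_zero A hk, ← neg_zero (G := ZMod (p ^ k)), ← heckeElt_neg, heckeElt_one_zero,
          Matrix.vecMul_neg, Matrix.vecMul_one] at h3
        funext i
        have h4 := congrFun h3 i
        rw [Pi.neg_apply] at h4
        change n i = 0
        linear_combination (-n i) * two_mul_inv_two hodd - 2⁻¹ * h4
      rw [h2, Nat.cast_one] at h1
      rw [Units.val_mul, hfv, hcinv, Units.val_one]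
      rw [hcinv] at h1
      linear_combination ((M (c : SL(2, ZMod (p ^ k)))).trace ^ 2) * hεε + h1)
    (by
      intro a b ha hb hab
      obtain ⟨x, rfl⟩ := exists_beta_eq_of_notMem hp hk hD ha
      obtain ⟨y, rfl⟩ := exists_beta_eq_of_notMem hp hk hD hb
      have hu : IsUnit ((x : ZMod (p ^ k)) + y) := by
        by_contra h
        exact hab ((beta_mul_mem_heckeKer_iff hp hk hD x y).mpr h)
      have h1 := trace_beta_mul_beta M hp hk hD hM x y
      rw [hε _ hu] at h1
      apply Units.ext
      rw [Units.val_mul, hfv, hfv, hfv]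
      apply mul_left_cancel₀ hpk
      linear_combination (-((ε : ℤ) : ℂ)) * h1)
    (by
      intro a b ha hb hab
      obtain ⟨x, rfl⟩ := exists_beta_eq_of_notMem hp hk hD ha
      obtain ⟨y, rfl⟩ := exists_beta_eq_of_notMem hp hk hD hb
      obtain ⟨z, hz, w, hw, hzw⟩ := exists_param_of_mul_mem_heckeKer hp hk hD x y hab
      have h1 := trace_beta_mul_beta M hp hk hD hM x y
      -- Both $\beta(x)\beta(y)$ and $c\,\beta(z)$ are the same element. The two formulas share a
      -- Gauss sum, nonzero because traces of the propagator never vanish, and it cancels.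
      have h2 := trace_beta_mul_beta M hp hk hD hM ⟨0, zero_mem_paramSet A hk⟩ z
      have h3 : beta A p k x * beta A p k y = c * beta A p k z := by
        rw [hz, ← mul_assoc, beta_zero_mul_self A hk, one_mul]
      simp only [zero_add] at h2
      rw [hzw, gaussQ_mul_unit A hp hk hD _ hw, ← hc, ← h3, h1] at h2
      have hg : gaussQ A ((x : ZMod (p ^ k)) + (y : ZMod (p ^ k))) ≠ 0 := by
        intro h0
        rw [h0, mul_zero] at h1
        exact mul_ne_zero hpk (ht0 _) h1
      have h4 := mul_right_cancel₀ hg h2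
      apply Units.ext
      rw [← hz, Units.val_mul, Units.val_mul, hfv, hfv, hfv, hfv]
      linear_combination (((ε : ℤ) : ℂ) ^ 2) * h4)
  refine ⟨ε, χ, fun x => ?_⟩
  rw [hχ _ (beta_notMem_heckeKer hp hk hD x), hfv, ← mul_assoc, hεε, one_mul]

variable {A} in
-- As $B\equiv1$ modulo $p$, every $p^{k-1}m$ is fixed by $B$. When $Q(n)$ is a unit some coordinate
-- of $n$ is a unit, and a suitable basis vector $m$ gives $\omega(n,p^{k-1}m)\ne0$.
lemma trace_eq_zero_of_mem_heckeKer (hp : p ≠ 2) (hk : 1 ≤ k) (hM : ∀ B, IsIntertwiner B (M B))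
    {B : heckeGroup A (p ^ k)} (hB : B ∈ heckeKer A hk) (n : Fin 2 → ZMod (p ^ k))
    (hn : IsUnit (quadMod A n)) :
    (heis n * M (B : SL(2, ZMod (p ^ k)))⁻¹).trace = 0 := by
  have hodd := odd_prime_pow hp k
  obtain ⟨i, hi⟩ : ∃ i, IsUnit (n i) := by
    by_contra! h
    have h0 : ∀ i, redHom p hk (n i) = 0 := fun i => by
      by_contra h1
      exact h i ((isUnit_iff_redHom_ne_zero hk _).mpr h1)
    apply (isUnit_iff_redHom_ne_zero hk _).mp hn
    simp [quadMod, sympMod, h0]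
  have hpow : (p : ZMod (p ^ k)) ^ (k - 1) ≠ 0 := by
    intro h
    have h1 : ((p ^ (k - 1) : ℕ) : ZMod (p ^ k)) = 0 := by exact_mod_cast h
    rw [ZMod.natCast_eq_zero_iff,
      Nat.pow_dvd_pow_iff_le_right (Fact.out : p.Prime).one_lt] at h1
    omega
  have hpp : (p : ZMod (p ^ k)) ^ (k - 1) * p = 0 := by
    rw [← pow_succ, Nat.sub_add_cancel hk]
    exact_mod_cast ZMod.natCast_self (p ^ k)
  have hfix : ∀ m : Fin 2 → ZMod (p ^ k), ((p : ZMod (p ^ k)) ^ (k - 1) • m) ᵥ*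
      ((B : SL(2, ZMod (p ^ k))) : Matrix (Fin 2) (Fin 2) (ZMod (p ^ k))) =
        (p : ZMod (p ^ k)) ^ (k - 1) • m := by
    intro m
    rw [mem_heckeKer_iff] at hB
    have h1 : ∀ i j, ∃ y, ((B : SL(2, ZMod (p ^ k))) : Matrix (Fin 2) (Fin 2) (ZMod (p ^ k))) i j =
        (1 : Matrix (Fin 2) (Fin 2) (ZMod (p ^ k))) i j + p * y := fun i j => by
      obtain ⟨y, hy⟩ := exists_eq_mul_of_redHom_eq_zero hk
        (x := ((B : SL(2, ZMod (p ^ k))) : Matrix (Fin 2) (Fin 2) (ZMod (p ^ k))) i j -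
          (1 : Matrix (Fin 2) (Fin 2) (ZMod (p ^ k))) i j) (by
            rw [map_sub, hB i j, sub_eq_zero]
            by_cases hij : i = j <;> simp [Matrix.one_apply, hij])
      exact ⟨y, by linear_combination hy⟩
    choose Y hY using h1
    have h2 : ((B : SL(2, ZMod (p ^ k))) : Matrix (Fin 2) (Fin 2) (ZMod (p ^ k))) =
        1 + (p : ZMod (p ^ k)) • Matrix.of Y := by
      ext i j; rw [hY]; simp
    rw [h2, Matrix.vecMul_add, Matrix.vecMul_one, Matrix.vecMul_smul, Matrix.smul_vecMul,
      smul_smul, mul_comm, hpp, zero_smul, add_zero]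
  have hne : ∀ t : ZMod (p ^ k), IsUnit t → (p : ZMod (p ^ k)) ^ (k - 1) * t ≠ 0 := fun t ht => by
    rw [Ne, ht.mul_left_eq_zero]; exact hpow
  fin_cases i
  · refine (hM _).trace_eq_zero hodd n _ (hfix ![0, 1]) ?_
    have h1 := hne _ hi
    simp only [sympMod, Pi.smul_apply, Matrix.cons_val_zero, Matrix.cons_val_one, smul_eq_mul,
      mul_zero, mul_one, sub_zero]
    rwa [mul_comm] at h1
  · refine (hM _).trace_eq_zero hodd n _ (hfix ![1, 0]) ?_
    have h1 := hne _ hi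
    simp only [sympMod, Pi.smul_apply, Matrix.cons_val_zero, Matrix.cons_val_one, smul_eq_mul,
      mul_zero, mul_one, zero_sub, neg_ne_zero]
    rwa [mul_comm] at h1

variable {A} in
theorem sum_char_mul_trace [Fintype (heckeGroup A (p ^ k))] (hp : p ≠ 2) (hk : 1 ≤ k)
    (hD : ¬ (p : ℤ) ∣ disc A) (hM : ∀ B, IsIntertwiner B (M B)) {ε : ℤˣ}
    {χ₀ : HeckeChar A (p ^ k)}
    (hχ₀ : ∀ x : paramSet A p k, (M (beta A p k x : SL(2, ZMod (p ^ k)))⁻¹).trace =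
        ((ε : ℤ) : ℂ) * (χ₀ (beta A p k x) : ℂ)) (χ : HeckeChar A (p ^ k))
    (n : Fin 2 → ZMod (p ^ k)) (hn : IsUnit (quadMod A n)) :
    ∑ B : heckeGroup A (p ^ k), (χ B : ℂ) * (heis n * M (B : SL(2, ZMod (p ^ k)))⁻¹).trace =
      ((ε : ℤ) : ℂ) * expSum A p k (quadMod A n * 2⁻¹) (χ * χ₀) := by
  classical
  rw [expSum, Finset.mul_sum]
  symm
  refine Fintype.sum_of_injective (beta A p k) (beta_injective hp hk hD) _ _ ?_ ?_
  · intro B hB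
    rw [trace_eq_zero_of_mem_heckeKer M hp hk hM _ n hn, mul_zero]
    by_contra h
    exact hB (exists_beta_eq_of_notMem hp hk hD h)
  · intro x
    rw [trace_heis_mul_beta M hp hk hM, hχ₀, MonoidHom.mul_apply, Units.val_mul,
      show (x : ZMod (p ^ k)) * quadMod A n * 2⁻¹ = quadMod A n * 2⁻¹ * x by ring]
    ring

end HeckeTrace

/-! ### Counting -/

section Counting

variable {p k : ℕ} [Fact p.Prime]

lemma card_redHom_eq_le (hk : 1 ≤ k) (r : ZMod p) :
    Fintype.card {x : ZMod (p ^ k) // redHom p hk x = r} ≤ p ^ (k - 1) := by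
  have hp := (Fact.out : p.Prime).pos
  rw [Fintype.card_subtype, ← Finset.card_range (p ^ (k - 1))]
  refine Finset.card_le_card_of_injOn (fun x => x.val / p) ?_ ?_
  · intro x _
    have hx := ZMod.val_lt x
    simp only [Finset.coe_range, Set.mem_Iio]
    rw [Nat.div_lt_iff_lt_mul hp, ← pow_succ, Nat.sub_add_cancel hk]
    exact hx
  · intro x hx y hy hxy
    simp only [Finset.coe_filter, Finset.mem_univ, true_and, Set.mem_ofPred_eq] at hx hy
    have h1 : ((x.val : ℕ) : ZMod p) = ((y.val : ℕ) : ZMod p) := by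
      rw [ZMod.natCast_val, ZMod.natCast_val]; exact hx.trans hy.symm
    rw [ZMod.natCast_eq_natCast_iff] at h1
    apply ZMod.val_injective
    have h2 := Nat.div_add_mod x.val p
    have h3 := Nat.div_add_mod y.val p
    have h1' : x.val % p = y.val % p := h1
    simp only at hxy
    rw [← h2, ← h3, hxy, h1']

lemma card_pow_dvd_val_le {j : ℕ} (hj : j ≤ k) :
    Fintype.card {x : ZMod (p ^ k) // p ^ j ∣ x.val} ≤ p ^ (k - j) := by
  have hp : 0 < p ^ j := pow_pos (Fact.out : p.Prime).pos j
  rw [Fintype.card_subtype, ← Finset.card_range (p ^ (k - j))]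
  refine Finset.card_le_card_of_injOn (fun x => x.val / p ^ j) ?_ ?_
  · intro x _
    have hx := ZMod.val_lt x
    simp only [Finset.coe_range, Set.mem_Iio]
    rw [Nat.div_lt_iff_lt_mul hp, ← pow_add, Nat.sub_add_cancel hj]
    exact hx
  · intro x hx y hy hxy
    simp only [Finset.coe_filter, Finset.mem_univ, true_and, Set.mem_ofPred_eq] at hx hy
    apply ZMod.val_injective
    exact (Nat.div_left_inj hx hy).mp hxy

/-- The number of solutions of `b y = 0`. -/
def annCard {N : ℕ} [NeZero N] (b : ZMod N) : ℕ := Fintype.card {y : ZMod N // b * y = 0}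

/-- If $by=0$, then $p^j\mid b$ and $p^{k-j}\mid y$ for some $j\le k$. Each $j$ contributes at most
$p^{k-j}$ values of $b$ with $p^j$ values of $y$ each. -/
lemma sum_annCard_le : ∑ b : ZMod (p ^ k), annCard b ≤ (k + 1) * p ^ k := by
  have h1 : ∀ b : ZMod (p ^ k), annCard b ≤ ∑ j ∈ Finset.range (k + 1),
      (if p ^ j ∣ b.val then p ^ j else 0) := by
    intro b
    have hsub : (Finset.univ.filter fun y : ZMod (p ^ k) => b * y = 0) ⊆
        (Finset.range (k + 1)).biUnion fun j => if p ^ j ∣ b.val then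
          (Finset.univ.filter fun y : ZMod (p ^ k) => p ^ (k - j) ∣ y.val) else ∅ := by
      intro y hy
      simp only [Finset.mem_filter, Finset.mem_univ, true_and] at hy
      have h2 : p ^ k ∣ b.val * y.val := by
        rw [← ZMod.natCast_eq_zero_iff, Nat.cast_mul, ZMod.natCast_zmod_val,
          ZMod.natCast_zmod_val, hy]
      obtain ⟨c, d, hc, hd, hcd⟩ := (Nat.dvd_mul).mp h2
      obtain ⟨j, hj, rfl⟩ := (Nat.dvd_prime_pow Fact.out).mp (Dvd.intro d hcd)
      have hd' : d = p ^ (k - j) := by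
        rw [← Nat.add_sub_cancel' hj, pow_add] at hcd
        have := Nat.eq_of_mul_eq_mul_left (pow_pos (Fact.out : p.Prime).pos j) hcd
        rw [this]
      simp only [Finset.mem_biUnion, Finset.mem_range]
      refine ⟨j, by omega, ?_⟩
      rw [if_pos hc]
      simp only [Finset.mem_filter, Finset.mem_univ, true_and]
      rw [← hd']; exact hd
    rw [annCard, Fintype.card_subtype]
    refine (Finset.card_le_card hsub).trans (Finset.card_biUnion_le.trans ?_)
    refine Finset.sum_le_sum fun j hj => ?_
    split_ifs
    · have hjk : j ≤ k := by simpa [Nat.lt_succ_iff] using hj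
      have := card_pow_dvd_val_le (p := p) (Nat.sub_le k j)
      rw [Fintype.card_subtype, Nat.sub_sub_self hjk] at this
      exact this
    · simp
  calc ∑ b : ZMod (p ^ k), annCard b
      ≤ ∑ b : ZMod (p ^ k), ∑ j ∈ Finset.range (k + 1),
        (if p ^ j ∣ b.val then p ^ j else 0) := Finset.sum_le_sum fun b _ => h1 b
    _ = ∑ j ∈ Finset.range (k + 1), ∑ b : ZMod (p ^ k),
        (if p ^ j ∣ b.val then p ^ j else 0) := Finset.sum_comm
    _ ≤ ∑ j ∈ Finset.range (k + 1), p ^ k := by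
        refine Finset.sum_le_sum fun j hj => ?_
        have hjk : j ≤ k := by simpa [Nat.lt_succ_iff] using hj
        rw [← Finset.sum_filter, Finset.sum_const, smul_eq_mul]
        have := card_pow_dvd_val_le (p := p) hjk
        rw [Fintype.card_subtype] at this
        calc _ ≤ p ^ (k - j) * p ^ j := Nat.mul_le_mul_right _ this
          _ = p ^ k := by rw [← pow_add, Nat.sub_add_cancel hjk]
    _ = _ := by simp

/-- The term $b=0$ is the main one. For $b\ne0$ the annihilator contains no unit, so one factor is
at most $p^{k-1}$ and the other is summed linearly. -/
lemma sum_annCard_sq_le (hk : 1 ≤ k) :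
    ∑ b : ZMod (p ^ k), annCard b ^ 2 ≤ (p ^ k) ^ 2 + p ^ (k - 1) * ((k + 1) * p ^ k) := by
  classical
  rw [← Finset.add_sum_erase _ _ (Finset.mem_univ (0 : ZMod (p ^ k)))]
  have h0 : annCard (0 : ZMod (p ^ k)) = p ^ k := by
    simp [annCard, ZMod.card]
  rw [h0]
  refine Nat.add_le_add_left ?_ _
  calc ∑ b ∈ Finset.univ.erase (0 : ZMod (p ^ k)), annCard b ^ 2
      ≤ ∑ b ∈ Finset.univ.erase (0 : ZMod (p ^ k)), p ^ (k - 1) * annCard b := by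
        refine Finset.sum_le_sum fun b hb => ?_
        rw [sq]
        refine Nat.mul_le_mul_right _ (le_trans ?_ (card_redHom_eq_le hk 0))
        refine Fintype.card_subtype_mono _ _ fun y hy => ?_
        by_contra h
        have hu := (isUnit_iff_redHom_ne_zero hk y).mpr h
        exact (Finset.ne_of_mem_erase hb) (hu.mul_left_eq_zero.mp hy)
    _ ≤ ∑ b : ZMod (p ^ k), p ^ (k - 1) * annCard b :=
        Finset.sum_le_sum_of_subset (Finset.erase_subset _ _)
    _ ≤ _ := by
        rw [← Finset.mul_sum]
        exact Nat.mul_le_mul_left _ sum_annCard_le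

variable {A : SL(2, ℤ)}

lemma card_fixed_of_notMem (hp : p ≠ 2) (hk : 1 ≤ k) (hD : ¬ (p : ℤ) ∣ disc A)
    {B : heckeGroup A (p ^ k)} (hB : B ∉ heckeKer A hk) :
    Fintype.card {n : Fin 2 → ZMod (p ^ k) // n ᵥ* ((B : SL(2, ZMod (p ^ k))) :
      Matrix (Fin 2) (Fin 2) (ZMod (p ^ k))) = n} ≤ 1 := by
  have h2 := two_mul_inv_two (odd_prime_pow hp k)
  obtain ⟨x, rfl⟩ := exists_beta_eq_of_notMem hp hk hD hB
  obtain ⟨u, hu⟩ := exists_inv_of_mem_paramSet hk x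
  rw [Fintype.card_le_one_iff]
  suffices h : ∀ n : Fin 2 → ZMod (p ^ k), n ᵥ* ((beta A p k x : SL(2, ZMod (p ^ k))) :
      Matrix (Fin 2) (Fin 2) (ZMod (p ^ k))) = n → n = 0 from
    fun n m => Subtype.ext ((h n.1 n.2).trans (h m.1 m.2).symm)
  intro n hn
  have h1 : heckeElt A (1 + 2 * u) (2 * (x : ZMod (p ^ k)) * u) = 1 +
      heckeElt A (2 * u) (2 * (x : ZMod (p ^ k)) * u) := by
    simp only [heckeElt]; module
  rw [beta_eq_heckeElt A x hu, h1, Matrix.vecMul_add, Matrix.vecMul_one, add_eq_left] at hn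
  have h3 : heckeElt A (2 * u) (2 * (x : ZMod (p ^ k)) * u) *
      heckeElt A (-2⁻¹) ((x : ZMod (p ^ k)) * 2⁻¹) = 1 := by
    rw [heckeElt_mul, ← heckeElt_one_zero A]
    congr 1
    · linear_combination (2 * 2⁻¹) * hu + h2
    · ring
  rw [← Matrix.vecMul_one n, ← h3, ← Matrix.vecMul_vecMul, hn, Matrix.zero_vecMul]

lemma card_fixed_le_annCard_sq (hp : p ≠ 2) (hk : 1 ≤ k) (hD : ¬ (p : ℤ) ∣ disc A)
    {B : heckeGroup A (p ^ k)} (hB : B ∈ heckeKer A hk) {a b : ZMod (p ^ k)}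
    (hab : ((B : SL(2, ZMod (p ^ k))) : Matrix (Fin 2) (Fin 2) (ZMod (p ^ k))) =
      heckeElt A a b) :
    Fintype.card {n : Fin 2 → ZMod (p ^ k) // n ᵥ* ((B : SL(2, ZMod (p ^ k))) :
      Matrix (Fin 2) (Fin 2) (ZMod (p ^ k))) = n} ≤ annCard b ^ 2 := by
  have hdet : a ^ 2 - (disc A : ZMod (p ^ k)) * b ^ 2 = 1 := by
    rw [← det_heckeElt, ← hab]; exact B.1.2
  rw [mem_heckeKer_iff_of_eq hp hk hD hab] at hB
  have hb : redHom p hk b = 0 := by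
    have h1 := congrArg (redHom p hk) hdet
    rw [map_sub, map_mul, map_pow, map_pow, hB, map_intCast, map_one] at h1
    have h2 : (disc A : ZMod p) * redHom p hk b ^ 2 = 0 := by linear_combination -h1
    simpa using (mul_eq_zero.mp h2).resolve_left (disc_ne_zero_mod hD)
  have ha : IsUnit (a + 1) := by
    rw [isUnit_iff_redHom_ne_zero hk, map_add, hB, map_one, one_add_one_eq_two]
    exact redHom_two_ne_zero hp
  obtain ⟨w, hw⟩ := ha.exists_right_inv
  -- The norm equation gives $a-1=Db^2/(a+1)$, so $B=1+bV$ with $V=Dbw+S$, $w=(a+1)^{-1}$. Modulo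
  -- $p$ this $V$ is $S$, hence invertible, and fixed vectors are killed by $b$.
  have hV : IsUnit (heckeElt A ((disc A : ZMod (p ^ k)) * b * w) 1) := by
    rw [Matrix.isUnit_iff_isUnit_det, det_heckeElt, isUnit_iff_redHom_ne_zero hk]
    simp [hb, disc_ne_zero_mod hD]
  have hfac : heckeElt A a b = 1 + b • heckeElt A ((disc A : ZMod (p ^ k)) * b * w) 1 := by
    have : a = 1 + b * ((disc A : ZMod (p ^ k)) * b * w) := by
      linear_combination (1 - a) * hw + w * hdet
    conv_lhs => rw [this]
    simp only [heckeElt]; module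
  have hkey : ∀ n : Fin 2 → ZMod (p ^ k), n ᵥ* ((B : SL(2, ZMod (p ^ k))) :
      Matrix (Fin 2) (Fin 2) (ZMod (p ^ k))) = n → ∀ i, b * n i = 0 := by
    intro n hn i
    rw [hab, hfac, Matrix.vecMul_add, Matrix.vecMul_one, add_eq_left, Matrix.vecMul_smul,
      ← Matrix.smul_vecMul] at hn
    obtain ⟨g, hg⟩ := hV
    have := congrArg (fun v => v ᵥ* (g⁻¹ : (Matrix (Fin 2) (Fin 2) (ZMod (p ^ k)))ˣ).1) hn
    simp only [← hg, Matrix.vecMul_vecMul, Units.mul_inv, Matrix.vecMul_one,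
      Matrix.zero_vecMul] at this
    exact congrFun this i
  have hcard : annCard b ^ 2 = Fintype.card (Fin 2 → {y : ZMod (p ^ k) // b * y = 0}) := by
    simp [annCard]
  rw [hcard]
  refine Fintype.card_le_of_injective (fun n i => ⟨n.1 i, hkey n.1 n.2 i⟩) ?_
  intro n m h
  apply Subtype.ext
  funext i
  exact congrArg Subtype.val (congrFun h i)

/-- An element of the Hecke group that is trivial modulo `p` is determined by its coefficient at
`√D`. -/
lemma exists_heckeKer_coeff (hp : p ≠ 2) (hk : 1 ≤ k) (hD : ¬ (p : ℤ) ∣ disc A) :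
    ∃ c : heckeKer (p := p) (k := k) A hk → {x : ZMod (p ^ k) // redHom p hk x = 0}, Function.Injective c ∧
      ∀ B : heckeKer (p := p) (k := k) A hk, ∃ a, ((B.1 : SL(2, ZMod (p ^ k))) : Matrix (Fin 2) (Fin 2) (ZMod (p ^ k))) =
        heckeElt A a (c B).1 := by
  have hodd := odd_prime_pow hp k
  have hDu := isUnit_disc (k := k) hk hD
  choose a b hab hdet using exists_eq_heckeElt A hodd hDu
  have ha : ∀ B : heckeKer A hk, redHom p hk (a B.1) = 1 := fun B =>
    (mem_heckeKer_iff_of_eq hp hk hD (hab B.1)).mp B.2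
  have hb : ∀ B : heckeKer A hk, redHom p hk (b B.1) = 0 := fun B => by
    have h1 := congrArg (redHom p hk) (hdet B.1)
    rw [map_sub, map_mul, map_pow, map_pow, ha, map_intCast, map_one] at h1
    have h2 : (disc A : ZMod p) * redHom p hk (b B.1) ^ 2 = 0 := by linear_combination -h1
    simpa using (mul_eq_zero.mp h2).resolve_left (disc_ne_zero_mod hD)
  refine ⟨fun B => ⟨b B.1, hb B⟩, ?_, fun B => ⟨a B.1, hab B.1⟩⟩
  intro B C hBC
  have hbc : b B.1 = b C.1 := congrArg Subtype.val hBC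
  have hu : IsUnit (a B.1 + a C.1) := by
    rw [isUnit_iff_redHom_ne_zero hk, map_add, ha, ha, one_add_one_eq_two]
    exact redHom_two_ne_zero hp
  have h1 : (a B.1 + a C.1) * (a B.1 - a C.1) = 0 := by
    have h2 := hdet B.1
    have h3 := hdet C.1
    rw [hbc] at h2
    linear_combination h2 - h3
  have h4 : a B.1 = a C.1 := sub_eq_zero.mp (hu.mul_right_eq_zero.mp h1)
  apply Subtype.ext
  apply Subtype.ext
  apply Subtype.ext
  rw [hab B.1, hab C.1, hbc, h4]

variable [Fintype (heckeGroup A (p ^ k))]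

lemma sum_card_fixed_le (hp : p ≠ 2) (hk : 1 ≤ k) (hD : ¬ (p : ℤ) ∣ disc A) :
    ∑ B : heckeGroup A (p ^ k), Fintype.card {n : Fin 2 → ZMod (p ^ k) //
      n ᵥ* ((B : SL(2, ZMod (p ^ k))) : Matrix (Fin 2) (Fin 2) (ZMod (p ^ k))) = n} ≤
      Fintype.card (heckeGroup A (p ^ k)) +
        ((p ^ k) ^ 2 + p ^ (k - 1) * ((k + 1) * p ^ k)) := by
  classical
  obtain ⟨c, hc, hca⟩ := exists_heckeKer_coeff (k := k) hp hk hD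
  rw [← Finset.sum_filter_add_sum_filter_not Finset.univ (fun B => B ∉ heckeKer A hk)]
  refine Nat.add_le_add ?_ ?_
  · refine (Finset.sum_le_card_nsmul _ _ 1 fun B hB => ?_).trans ?_
    · exact card_fixed_of_notMem hp hk hD (Finset.mem_filter.mp hB).2
    · rw [smul_eq_mul, mul_one]
      exact Finset.card_le_univ _
  · simp only [not_not]
    rw [← Finset.sum_subtype_of_mem (p := fun B => B ∈ heckeKer A hk) _
      (fun B hB => (Finset.mem_filter.mp hB).2)]
    calc _ ≤ ∑ B : heckeKer A hk, annCard (c B).1 ^ 2 := by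
          refine (Finset.sum_le_sum fun B _ => ?_).trans
            (Finset.sum_le_univ_sum_of_nonneg fun _ => Nat.zero_le _)
          obtain ⟨a, ha⟩ := hca B
          exact card_fixed_le_annCard_sq hp hk hD B.2 ha
      _ ≤ ∑ b : ZMod (p ^ k), annCard b ^ 2 := by
          rw [← Finset.sum_image (f := fun b => annCard b ^ 2) (g := fun B => (c B).1)
            (fun B _ C _ h => hc (Subtype.ext h))]
          exact Finset.sum_le_univ_sum_of_nonneg fun _ => Nat.zero_le _
      _ ≤ _ := sum_annCard_sq_le hk

/-- At most two residue classes modulo $p$ are removed from $X(p^k)$, and $\beta$ is injective. -/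
lemma card_paramSet_le_card_heckeGroup (hp : p ≠ 2) (hk : 1 ≤ k) (hD : ¬ (p : ℤ) ∣ disc A) :
    p ^ k ≤ Fintype.card (heckeGroup A (p ^ k)) + 2 * p ^ (k - 1) := by
  classical
  have h1 : Fintype.card (paramSet A p k) ≤ Fintype.card (heckeGroup A (p ^ k)) :=
    Fintype.card_le_of_injective _ (beta_injective hp hk hD)
  have h2 : Fintype.card {x : ZMod (p ^ k) // x ∉ paramSet A p k} ≤ 2 * p ^ (k - 1) := by
    by_cases hex : ∃ r : ZMod p, (disc A : ZMod p) * r ^ 2 = 1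
    · obtain ⟨r, hr⟩ := hex
      have hmem : ∀ x : ZMod (p ^ k), x ∉ paramSet A p k →
          redHom p hk x = r ∨ redHom p hk x = -r := fun x hx => by
        have h3 : (disc A : ZMod p) * redHom p hk x ^ 2 = 1 := not_not.mp hx
        apply sq_eq_sq_iff_eq_or_eq_neg.mp
        exact mul_left_cancel₀ (disc_ne_zero_mod hD) (h3.trans hr.symm)
      calc _ ≤ Fintype.card {x : ZMod (p ^ k) // redHom p hk x = r ∨ redHom p hk x = -r} :=
            Fintype.card_subtype_mono _ _ hmem
        _ ≤ _ := Fintype.card_subtype_or _ _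
        _ ≤ _ := by
          rw [two_mul]
          exact Nat.add_le_add (card_redHom_eq_le hk r) (card_redHom_eq_le hk (-r))
    · have : IsEmpty {x : ZMod (p ^ k) // x ∉ paramSet A p k} :=
        ⟨fun x => hex ⟨redHom p hk x.1, not_not.mp x.2⟩⟩
      simp
  have h3 := Fintype.card_subtype_compl (fun x : ZMod (p ^ k) => x ∈ paramSet A p k)
  rw [ZMod.card] at h3
  have h4 : Fintype.card {x : ZMod (p ^ k) // x ∈ paramSet A p k} =
    Fintype.card (paramSet A p k) := rfl
  omega

lemma card_heckeGroup_le (hp : p ≠ 2) (hk : 1 ≤ k) (hD : ¬ (p : ℤ) ∣ disc A) :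
    Fintype.card (heckeGroup A (p ^ k)) ≤ p ^ k + p ^ (k - 1) := by
  classical
  obtain ⟨c, hc, -⟩ := exists_heckeKer_coeff (k := k) hp hk hD
  have h1 : Fintype.card (heckeKer (p := p) (k := k) A hk) ≤ p ^ (k - 1) :=
    (Fintype.card_le_of_injective c hc).trans (card_redHom_eq_le hk 0)
  have h2 : Fintype.card {B : heckeGroup A (p ^ k) // B ∉ heckeKer A hk} ≤ p ^ k := by
    choose f hf using fun B : {B : heckeGroup A (p ^ k) // B ∉ heckeKer A hk} =>
      exists_beta_eq_of_notMem hp hk hD B.2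
    have : Function.Injective (fun B => (f B : ZMod (p ^ k))) := fun B C h => by
      have := Subtype.ext (a1 := f B) (a2 := f C) h
      apply Subtype.ext
      rw [← hf B, ← hf C, this]
    simpa [ZMod.card] using Fintype.card_le_of_injective _ this
  have h3 := Fintype.card_subtype_compl (fun B : heckeGroup A (p ^ k) => B ∈ heckeKer A hk)
  have h4 : Fintype.card {B : heckeGroup A (p ^ k) // B ∈ heckeKer A hk} =
    Fintype.card (heckeKer (p := p) (k := k) A hk) := rfl
  omega

end Counting

/-! ### Observables -/

lemma mFourierCoeff_mFourier {d : Type*} [Fintype d] [DecidableEq d] (n m : d → ℤ) :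
    UnitAddTorus.mFourierCoeff (UnitAddTorus.mFourier n) m = if m = n then (1 : ℂ) else 0 := by
  have h := orthonormal_iff_ite.mp (UnitAddTorus.orthonormal_mFourier (d := d)) m n
  rw [← h, ← UnitAddTorus.coe_mFourierBasis, ← HilbertBasis.repr_apply_apply,
    UnitAddTorus.mFourierBasis_repr, UnitAddTorus.coe_mFourierBasis]
  exact (UnitAddTorus.mFourierCoeff_toLp (UnitAddTorus.mFourier n) m).symm

lemma opN_mFourier {N : ℕ} [NeZero N] (n : Fin 2 → ℤ) (ψ : State N) :
    opN N (UnitAddTorus.mFourier n) ψ = elemOp N n ψ := by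
  funext y
  rw [opN, tsum_eq_single n (fun m hm => by rw [mFourierCoeff_mFourier, if_neg hm, zero_mul]),
    mFourierCoeff_mFourier, if_pos rfl, one_mul]

/-! ### Hecke eigenfunctions -/

section Braket

variable {N : ℕ} [NeZero N]

/-- The linear form `φ ↦ ⟨φ, ψ⟩`. -/
noncomputable def braketLeft (ψ : State N) : State N →ₗ[ℂ] ℂ where
  toFun φ := braket φ ψ
  map_add' φ φ' := by
    simp only [braket, Pi.add_apply, add_mul, Finset.sum_add_distrib, mul_add]
  map_smul' c φ := by
    simp only [braket, Pi.smul_apply, smul_eq_mul, RingHom.id_apply, Finset.mul_sum]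
    exact Finset.sum_congr rfl fun y _ => by ring

lemma braketLeft_apply (φ ψ : State N) : braketLeft ψ φ = braket φ ψ := rfl

lemma braket_smul_left (c : ℂ) (φ ψ : State N) : braket (c • φ) ψ = c * braket φ ψ :=
  (braketLeft ψ).map_smul c φ

lemma braket_smul_right (c : ℂ) (φ ψ : State N) : braket φ (c • ψ) = conj c * braket φ ψ := by
  simp only [braket, Pi.smul_apply, smul_eq_mul, map_mul, Finset.mul_sum]
  exact Finset.sum_congr rfl fun y _ => by ring

variable {A : SL(2, ℤ)} (U : SL(2, ZMod N) →* Module.End ℂ (State N))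

/-- The restriction of a propagator to the Hecke group. -/
def heckeRep (A : SL(2, ℤ)) : heckeGroup A N →* Module.End ℂ (State N) :=
  U.comp (heckeGroup A N).subtype

/-- Where the joint eigenspace is a line, the projection to it is `φ ↦ ⟨φ, ψ⟩ ψ`, so that
expectation values are traces. -/
lemma braket_apply_self_eq_trace [Fintype (heckeGroup A N)] {U} (hU : IsPropagator N U)
    {χ : HeckeChar A N} (hχ : Module.finrank ℂ (jointEigenspace (heckeRep U A) χ) = 1)
    {ψ : State N} (hψ : IsHeckeEigenfunction U χ ψ) (h1 : braket ψ ψ = 1)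
    (T : Module.End ℂ (State N)) :
    braket (T ψ) ψ = (Fintype.card (heckeGroup A N) : ℂ)⁻¹ *
      ∑ B : heckeGroup A N, (χ B : ℂ) * LinearMap.trace ℂ (State N) (T * U (B : SL(2, ZMod N))⁻¹) := by
  have hc : (Fintype.card (heckeGroup A N) : ℂ) ≠ 0 := Nat.cast_ne_zero.mpr Fintype.card_ne_zero
  have hproj : ∀ φ, jointProj (heckeRep U A) χ φ = braket φ ψ • ψ := by
    intro φ
    obtain ⟨c, hcφ⟩ := (finrank_eq_one_iff_of_nonzero'
      (⟨ψ, hψ.2⟩ : jointEigenspace (heckeRep U A) χ) (fun h => hψ.1 (congrArg Subtype.val h))).mp hχ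
      ⟨_, (isProj_jointProj (heckeRep U A) χ).map_mem φ⟩
    have hcφ' : c • ψ = jointProj (heckeRep U A) χ φ := congrArg Subtype.val hcφ
    -- The projection does not change the pairing with $\psi$: by unitarity every term of the
    -- average pairs to $\langle\phi,\psi\rangle$. That $|\chi(B)|=1$ follows from the norm of
    -- $\psi$.
    have h2 : braket (jointProj (heckeRep U A) χ φ) ψ = braket φ ψ := by
      have h3 : ∀ B : heckeGroup A N,
          (χ B : ℂ) * braket (U (B : SL(2, ZMod N))⁻¹ φ) ψ = braket φ ψ := fun B => by
        have h4 := hU.unitary B (U (B : SL(2, ZMod N))⁻¹ φ) ψ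
        have h5 := hU.unitary B ψ ψ
        rw [hψ.2 B, braket_smul_left, braket_smul_right, h1, mul_one] at h5
        rw [hψ.2 B, braket_smul_right, ← Module.End.mul_apply, ← map_mul, mul_inv_cancel, map_one,
          Module.End.one_apply] at h4
        rw [← h4, ← mul_assoc, h5, one_mul]
      rw [← braketLeft_apply, jointProj, LinearMap.smul_apply, LinearMap.sum_apply, map_smul,
        map_sum]
      have h6 : ∀ B : heckeGroup A N,
          braketLeft ψ (((χ B : ℂ) • heckeRep U A B⁻¹) φ) = braket φ ψ := fun B => by
        rw [LinearMap.smul_apply, map_smul, braketLeft_apply]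
        exact h3 B
      simp only [h6, Finset.sum_const, Finset.card_univ, nsmul_eq_mul, smul_eq_mul]
      rw [inv_mul_cancel_left₀ hc]
    rw [← h2, ← hcφ', braket_smul_left, h1, mul_one]
  have hT : T * jointProj (heckeRep U A) χ = (braketLeft ψ).smulRight (T ψ) := by
    ext1 y
    refine LinearMap.ext fun c => ?_
    simp only [LinearMap.comp_apply, Module.End.mul_apply, hproj, map_smul,
      LinearMap.smulRight_apply, braketLeft_apply]
  rw [← braketLeft_apply, ← LinearMap.trace_smulRight, ← hT, jointProj, mul_smul_comm, map_smul,
    Finset.mul_sum, map_sum, smul_eq_mul]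
  congr 1
  refine Finset.sum_congr rfl fun B _ => ?_
  rw [mul_smul_comm, map_smul, smul_eq_mul]
  rfl

lemma exists_unique_eigenfunction {χ : HeckeChar A N}
    (hχ : Module.finrank ℂ (jointEigenspace (heckeRep U A) χ) = 1) :
    ∃ ψ : State N, IsHeckeEigenfunction U χ ψ ∧
      ∀ φ : State N, IsHeckeEigenfunction U χ φ → ∃ c : ℂ, φ = c • ψ := by
  obtain ⟨v, hv, hspan⟩ := finrank_eq_one_iff'.mp hχ
  refine ⟨v.1, ⟨fun h => hv (Subtype.ext h), v.2⟩, fun φ hφ => ?_⟩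
  obtain ⟨c, hc⟩ := hspan ⟨φ, hφ.2⟩
  exact ⟨c, (congrArg Subtype.val hc).symm⟩

/-- The propagator in matrix form. -/
noncomputable def propMatrix : SL(2, ZMod N) →* Matrix (ZMod N) (ZMod N) ℂ :=
  (LinearMap.toMatrixAlgEquiv' (R := ℂ) (n := ZMod N)).toMonoidHom.comp U

lemma propMatrix_apply (B : SL(2, ZMod N)) : propMatrix U B = LinearMap.toMatrix' (U B) := rfl

/-- The Egorov property concerns integer vectors, so residues are lifted by their standard
representatives. -/
lemma isIntertwiner_propMatrix (hN : Odd N) (hU : IsPropagator N U) (B : SL(2, ZMod N)) :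
    IsIntertwiner B (propMatrix U B) := by
  intro n
  set m := n ᵥ* (B : Matrix (Fin 2) (Fin 2) (ZMod N)) with hm
  have hn : (fun i => (((n i).val : ℤ) : ZMod N)) = n := by funext i; simp
  have hm' : (fun i => (((m i).val : ℤ) : ZMod N)) = m := by funext i; simp
  have h := hU.egorov B (fun i => ((n i).val : ℤ)) (fun i => ((m i).val : ℤ)) (by
    rw [hn, hm', hm])
  have h1 : twistedOp N (fun i => ((n i).val : ℤ)) * U B =
      U B * twistedOp N (fun i => ((m i).val : ℤ)) := by
    rw [← h, ← mul_assoc, ← mul_assoc, ← map_mul, mul_inv_cancel, map_one, one_mul]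
  rw [twistedOp_eq_toLin hN, twistedOp_eq_toLin hN, hn, hm'] at h1
  have h2 := congrArg LinearMap.toMatrix' h1
  rw [LinearMap.toMatrix'_mul, LinearMap.toMatrix'_mul, LinearMap.toMatrix'_toLin',
    LinearMap.toMatrix'_toLin'] at h2
  exact h2

lemma trace_mul_eq_trace_propMatrix (X : Matrix (ZMod N) (ZMod N) ℂ) (B : SL(2, ZMod N)) :
    LinearMap.trace ℂ (State N) (Matrix.toLin' X * U B) = (X * propMatrix U B).trace := by
  rw [← Matrix.trace_toLin'_eq, Matrix.toLin'_mul, propMatrix_apply, Matrix.toLin'_toMatrix']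
  rfl

lemma trace_eq_trace_propMatrix (B : SL(2, ZMod N)) :
    LinearMap.trace ℂ (State N) (U B) = (propMatrix U B).trace := by
  rw [← Matrix.trace_toLin'_eq, propMatrix_apply, Matrix.toLin'_toMatrix']

end Braket

/-! ### Multiplicity one and expectation values -/

section PrimePower

variable {p k : ℕ} [Fact p.Prime] {A : SL(2, ℤ)}
  {U : SL(2, ZMod (p ^ k)) →* Module.End ℂ (State (p ^ k))}

/-- The number of characters of multiplicity one. -/
theorem ncard_mult_one_bounds (hp : p ≠ 2) (hk : 1 ≤ k) (hD : ¬ (p : ℤ) ∣ disc A)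
    (hU : IsPropagator (p ^ k) U) (hp3 : 3 ≤ p) :
    2 - 1 / (p : ℝ) - (1 + (k + 1) / p) / (1 - 2 / p) ≤
      ({χ : HeckeChar A (p ^ k) |
        Module.finrank ℂ (jointEigenspace (heckeRep U A) χ) = 1}.ncard : ℝ) / (p : ℝ) ^ k ∧
    ({χ : HeckeChar A (p ^ k) |
        Module.finrank ℂ (jointEigenspace (heckeRep U A) χ) = 1}.ncard : ℝ) / (p : ℝ) ^ k ≤
      1 + 1 / p := by
  classical
  let : Fintype (heckeGroup A (p ^ k)) := Fintype.ofFinite _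
  have hodd := odd_prime_pow hp k
  have hcomm := heckeGroup_comm A hodd (isUnit_disc (k := k) hk hD)
  have : Finite (HeckeChar A (p ^ k)) := finite_dual hcomm
  have hM := isIntertwiner_propMatrix U hodd hU
  set S : ℕ := ∑ B : heckeGroup A (p ^ k), Fintype.card {n : Fin 2 → ZMod (p ^ k) //
      n ᵥ* ((B : SL(2, ZMod (p ^ k))) : Matrix (Fin 2) (Fin 2) (ZMod (p ^ k))) = n} with hS
  have hSle := sum_card_fixed_le (k := k) hp hk hD
  rw [← hS] at hSle
  have hbad := card_mult_ne_one_le hcomm (heckeRep U A) (S : ℝ) (by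
    rw [hS]
    push_cast
    refine Finset.sum_congr rfl fun B _ => ?_
    have := trace_mul_trace_inv hodd (propMatrix U) hM (B : SL(2, ZMod (p ^ k)))
    rw [← trace_eq_trace_propMatrix, ← trace_eq_trace_propMatrix] at this
    exact this)
  have hlow := card_paramSet_le_card_heckeGroup (k := k) hp hk hD
  have hup := card_heckeGroup_le (k := k) hp hk hD
  have hcompl := Set.ncard_add_ncard_compl
    {χ : HeckeChar A (p ^ k) | Module.finrank ℂ (jointEigenspace (heckeRep U A) χ) = 1}
  rw [card_dual hcomm] at hcompl
  have hcompl' : ({χ : HeckeChar A (p ^ k) |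
      Module.finrank ℂ (jointEigenspace (heckeRep U A) χ) = 1}ᶜ).ncard =
      {χ : HeckeChar A (p ^ k) |
        Module.finrank ℂ (jointEigenspace (heckeRep U A) χ) ≠ 1}.ncard := rfl
  rw [hcompl'] at hcompl
  have hdim : Module.finrank ℂ (State (p ^ k)) = p ^ k := by
    rw [Module.finrank_fintype_fun_eq_card, ZMod.card]
  rw [hdim] at hbad
  generalize {χ : HeckeChar A (p ^ k) |
    Module.finrank ℂ (jointEigenspace (heckeRep U A) χ) = 1}.ncard = g at *
  generalize {χ : HeckeChar A (p ^ k) |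
    Module.finrank ℂ (jointEigenspace (heckeRep U A) χ) ≠ 1}.ncard = b at *
  generalize Fintype.card (heckeGroup A (p ^ k)) = c at *
  clear_value S
  have hpR : (3 : ℝ) ≤ p := by exact_mod_cast hp3
  have hpp : (p : ℝ) ^ k = p * (p : ℝ) ^ (k - 1) := by
    rw [← pow_succ', Nat.sub_add_cancel hk]
  set r : ℝ := (p : ℝ) ^ (k - 1) with hr
  have hr1 : 1 ≤ r := one_le_pow₀ (by linarith)
  have hcompR : (g : ℝ) + b = c := by exact_mod_cast hcompl
  have hlowR : (p : ℝ) * r ≤ c + 2 * r := by rw [← hpp, hr]; exact_mod_cast hlow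
  have hupR : (c : ℝ) ≤ p * r + r := by rw [← hpp, hr]; exact_mod_cast hup
  have hSR : (S : ℝ) ≤ c + ((p * r) ^ 2 + r * ((k + 1) * (p * r))) := by
    rw [← hpp, hr]; exact_mod_cast hSle
  push_cast at hbad
  rw [hpp] at hbad ⊢
  have hp0 : (0 : ℝ) < p := by linarith
  have hq0 : 0 < (p : ℝ) * r := by positivity
  -- The bound $p\ge3$ makes this lower estimate for $|C|$ positive.
  have hc0 : 0 < (p - 2) * r := by nlinarith
  have hcge : (p - 2) * r ≤ c := by linarith
  have hcpos : (0 : ℝ) < c := by linarith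
  constructor
  · rw [le_div_iff₀ hq0]
    -- The number of good characters is at least $2p^k-S/|C|$. The summand $1$ here is absorbed in
    -- $r=p^{k-1}$, the source of the term $1/p$ in the lower bound.
    have hSc : (S : ℝ) / c ≤ 1 + (p * r) * (1 + (k + 1) / p) / (1 - 2 / p) := by
      have h1 : (S : ℝ) / c ≤ 1 + ((p * r) ^ 2 + r * ((k + 1) * (p * r))) / c := by
        rw [div_le_iff₀ hcpos, add_mul, div_mul_cancel₀ _ hcpos.ne', one_mul]
        exact hSR
      have h2 : ((p * r) ^ 2 + r * ((k + 1) * (p * r))) / c ≤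
          ((p * r) ^ 2 + r * ((k + 1) * (p * r))) / ((p - 2) * r) :=
        div_le_div_of_nonneg_left (by positivity) hc0 hcge
      have h3 : ((p * r) ^ 2 + r * ((k + 1) * (p * r))) / ((p - 2) * r) =
          (p * r) * (1 + (k + 1) / p) / (1 - 2 / p) := by
        have : (p : ℝ) - 2 ≠ 0 := by linarith
        field_simp
      linarith
    have h4 : (2 - 1 / (p : ℝ) - (1 + (k + 1) / p) / (1 - 2 / p)) * (p * r) =
        2 * (p * r) - r - (p * r) * (1 + (k + 1) / p) / (1 - 2 / p) := by
      field_simp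
    rw [h4]
    linarith
  · rw [div_le_iff₀ hq0]
    have h5 : (1 + 1 / (p : ℝ)) * (p * r) = p * r + r := by field_simp
    rw [h5]
    have : (0 : ℝ) ≤ b := Nat.cast_nonneg b
    linarith

/-- Expectation values of the elementary operators in Hecke eigenfunctions. -/
theorem exists_expectation_eq_expSum (hp : p ≠ 2) (hk : 1 ≤ k) (hD : ¬ (p : ℤ) ∣ disc A)
    (hU : IsPropagator (p ^ k) U) :
    ∃ (ε : ℤˣ) (χ₀ : HeckeChar A (p ^ k)), ∀ χ : HeckeChar A (p ^ k),
      Module.finrank ℂ (jointEigenspace (heckeRep U A) χ) = 1 →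
      ∀ ψ : State (p ^ k), IsHeckeEigenfunction U χ ψ → braket ψ ψ = 1 →
      ∀ n : Fin 2 → ℤ, ¬ (p : ℤ) ∣ quadForm A n →
        braket (opN (p ^ k) (UnitAddTorus.mFourier n) ψ) ψ =
          ((ε : ℤ) : ℂ) * ((-1 : ℂ) ^ (n 0 * n 1) / (Nat.card (heckeGroup A (p ^ k)) : ℂ)) *
            expSum A p k ((quadForm A n : ZMod (p ^ k)) * 2⁻¹) (χ * χ₀) := by
  classical
  let : Fintype (heckeGroup A (p ^ k)) := Fintype.ofFinite _
  have hodd := odd_prime_pow hp k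
  have hM := isIntertwiner_propMatrix U hodd hU
  obtain ⟨ε, χ₀, hχ₀⟩ := exists_char_eq_trace_beta (propMatrix U) hp hk hD hM
  refine ⟨ε, χ₀, fun χ hχ ψ hψ h1 n hn => ?_⟩
  have hQ : IsUnit (quadMod A (fun i => (n i : ZMod (p ^ k)))) := by
    rw [quadMod_intCast, isUnit_iff_redHom_ne_zero hk, map_intCast, Ne,
      ZMod.intCast_zmod_eq_zero_iff_dvd]
    exact hn
  have hsum := sum_char_mul_trace (propMatrix U) hp hk hD hM hχ₀ χ _ hQ
  rw [quadMod_intCast] at hsum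
  rw [opN_mFourier, elemOp_eq_smul_twistedOp, LinearMap.smul_apply, braket_smul_left,
    braket_apply_self_eq_trace hU hχ hψ h1, twistedOp_eq_toLin hodd]
  simp only [trace_mul_eq_trace_propMatrix]
  rw [hsum, Nat.card_eq_fintype_card]
  ring

end PrimePower

end CatMap

/-! ### Choice of the data and the limit over primes. -/

theorem theorem1 (A : Matrix.SpecialLinearGroup (Fin 2) ℤ)
    (hA : 2 < |(A : Matrix (Fin 2) (Fin 2) ℤ).trace|) :
    -- the quantum propagators exist at every odd prime power
    (∀ (p k : ℕ) [Fact p.Prime], p ≠ 2 → 1 ≤ k →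
      ∃ U : Matrix.SpecialLinearGroup (Fin 2) (ZMod (p ^ k)) →*
          Module.End ℂ (CatMap.State (p ^ k)),
        CatMap.IsPropagator (p ^ k) U) ∧
    -- and the result holds for every choice of them
    ∀ U : ∀ p k : ℕ, Matrix.SpecialLinearGroup (Fin 2) (ZMod (p ^ k)) →*
        Module.End ℂ (CatMap.State (p ^ k)),
      (∀ (p k : ℕ) [Fact p.Prime], p ≠ 2 → 1 ≤ k → CatMap.IsPropagator (p ^ k) (U p k)) →
      ∃ (C₀ : ∀ p k : ℕ, Set (CatMap.HeckeChar A (p ^ k)))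
        (χ₀ : ∀ p k : ℕ, CatMap.HeckeChar A (p ^ k))
        (ε : ℕ → ℕ → ℤˣ),
        (∀ k : ℕ, 1 ≤ k →
          Filter.Tendsto (fun p : ℕ => ((C₀ p k).ncard : ℝ) / (p : ℝ) ^ k)
            (Filter.atTop ⊓ Filter.principal {p : ℕ | p.Prime}) (nhds 1)) ∧
        ∀ (p k : ℕ) [Fact p.Prime], p ≠ 2 → 1 ≤ k → ∀ χ ∈ C₀ p k,
          (∃ ψ : CatMap.State (p ^ k), CatMap.IsHeckeEigenfunction (U p k) χ ψ ∧
            ∀ φ : CatMap.State (p ^ k), CatMap.IsHeckeEigenfunction (U p k) χ φ →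
              ∃ c : ℂ, φ = c • ψ) ∧
          ∀ ψ : CatMap.State (p ^ k), CatMap.IsHeckeEigenfunction (U p k) χ ψ →
            CatMap.braket ψ ψ = 1 →
            ∀ n : Fin 2 → ℤ, ¬ (p : ℤ) ∣ CatMap.quadForm A n →
              CatMap.braket (CatMap.opN (p ^ k) (UnitAddTorus.mFourier n) ψ) ψ =
                ((ε p k : ℤ) : ℂ) *
                  ((-1 : ℂ) ^ (n 0 * n 1) / (Nat.card (CatMap.heckeGroup A (p ^ k)) : ℂ)) *
                  CatMap.expSum A p k ((CatMap.quadForm A n : ZMod (p ^ k)) * 2⁻¹) (χ * χ₀ p k) := by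
  refine ⟨fun p k _ hp hk => CatMap.exists_isPropagator (CatMap.odd_prime_pow hp k), ?_⟩
  intro U hU
  have hmain : ∀ p k : ℕ, ∃ (ε : ℤˣ) (χ₀ : CatMap.HeckeChar A (p ^ k)),
      ∀ [Fact p.Prime], p ≠ 2 → 1 ≤ k → ¬ (p : ℤ) ∣ CatMap.disc A →
      ∀ χ : CatMap.HeckeChar A (p ^ k),
      Module.finrank ℂ (CatMap.jointEigenspace (CatMap.heckeRep (U p k) A) χ) = 1 →
      ∀ ψ : CatMap.State (p ^ k), CatMap.IsHeckeEigenfunction (U p k) χ ψ →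
        CatMap.braket ψ ψ = 1 →
      ∀ n : Fin 2 → ℤ, ¬ (p : ℤ) ∣ CatMap.quadForm A n →
        CatMap.braket (CatMap.opN (p ^ k) (UnitAddTorus.mFourier n) ψ) ψ =
          ((ε : ℤ) : ℂ) *
            ((-1 : ℂ) ^ (n 0 * n 1) / (Nat.card (CatMap.heckeGroup A (p ^ k)) : ℂ)) *
            CatMap.expSum A p k ((CatMap.quadForm A n : ZMod (p ^ k)) * 2⁻¹) (χ * χ₀) := by
    intro p k
    by_cases h : p.Prime ∧ p ≠ 2 ∧ 1 ≤ k ∧ ¬ (p : ℤ) ∣ CatMap.disc A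
    · obtain ⟨hp, hp2, hk, hD⟩ := h
      have : Fact p.Prime := ⟨hp⟩
      obtain ⟨ε, χ₀, hχ₀⟩ := CatMap.exists_expectation_eq_expSum hp2 hk hD (hU p k hp2 hk)
      exact ⟨ε, χ₀, fun _ _ _ => hχ₀⟩
    -- Default values where nothing is claimed, in particular for composite $p$.
    · exact ⟨1, 1, fun {hp} hp2 hk hD => (h ⟨hp.out, hp2, hk, hD⟩).elim⟩
  choose ε χ₀ hεχ₀ using hmain
  -- For $p\mid D$ the set is empty. This affects finitely many primes, hence not the limit.
  refine ⟨fun p k => {χ | ¬ (p : ℤ) ∣ CatMap.disc A ∧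
    Module.finrank ℂ (CatMap.jointEigenspace (CatMap.heckeRep (U p k) A) χ) = 1},
    χ₀, ε, ?_, ?_⟩
  · intro k hk
    have hinv : Filter.Tendsto (fun p : ℕ => (p : ℝ)⁻¹) Filter.atTop (nhds 0) :=
      tendsto_inv_atTop_nhds_zero_nat
    have hlow : Filter.Tendsto (fun p : ℕ => 2 - 1 / (p : ℝ) -
        (1 + ((k : ℝ) + 1) / p) / (1 - 2 / p)) Filter.atTop (nhds 1) := by
      have h := (((tendsto_const_nhds (x := (2 : ℝ))).sub hinv).sub
        (((tendsto_const_nhds (x := (1 : ℝ))).add (hinv.const_mul ((k : ℝ) + 1))).div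
          ((tendsto_const_nhds (x := (1 : ℝ))).sub (hinv.const_mul 2)) (by norm_num)))
      norm_num at h
      simpa only [div_eq_mul_inv, one_mul] using h
    have hup : Filter.Tendsto (fun p : ℕ => 1 + 1 / (p : ℝ)) Filter.atTop (nhds 1) := by
      simpa using (tendsto_const_nhds (x := (1 : ℝ))).add hinv
    -- Hyperbolicity enters here: $D\ne0$ leaves only finitely many primes dividing it.
    have hdisc : CatMap.disc A ≠ 0 := by
      have h1 : (4 : ℤ) < (A : Matrix (Fin 2) (Fin 2) ℤ).trace ^ 2 := by
        rw [← sq_abs]; nlinarith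
      rw [CatMap.disc]; omega
    have hev : ∀ᶠ p : ℕ in Filter.atTop ⊓ Filter.principal {p : ℕ | p.Prime},
        p.Prime ∧ 3 ≤ p ∧ ¬ (p : ℤ) ∣ CatMap.disc A := by
      rw [Filter.eventually_inf_principal]
      filter_upwards [Filter.eventually_ge_atTop 3,
        Filter.eventually_gt_atTop (CatMap.disc A).natAbs] with p h3 hgt hp
      refine ⟨hp, h3, fun hdvd => ?_⟩
      have := Nat.le_of_dvd (Int.natAbs_pos.mpr hdisc) (Int.natCast_dvd.mp hdvd)
      omega
    have hbounds : ∀ p : ℕ, (p.Prime ∧ 3 ≤ p ∧ ¬ (p : ℤ) ∣ CatMap.disc A) → _ :=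
      fun p h => by
        have : Fact p.Prime := ⟨h.1⟩
        have hp2 : p ≠ 2 := by omega
        exact CatMap.ncard_mult_one_bounds hp2 hk h.2.2 (hU p k hp2 hk) h.2.1
    refine tendsto_of_tendsto_of_tendsto_of_le_of_le' (hlow.mono_left inf_le_left)
      (hup.mono_left inf_le_left) ?_ ?_
    · filter_upwards [hev] with p h
      simpa only [h.2.2, not_false_eq_true, true_and] using (hbounds p h).1
    · filter_upwards [hev] with p h
      simpa only [h.2.2, not_false_eq_true, true_and] using (hbounds p h).2
  · rintro p k _ hp hk χ ⟨hD, hχ⟩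
    exact ⟨CatMap.exists_unique_eigenfunction (U p k) hχ, hεχ₀ p k hp hk hD χ hχ⟩
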